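/- Let $l\ge 1$ be an integer, $m=2l-1$, and let $(M,g,J)$ be a smooth Kähler manifold of complex dimension $m$ (real dimension $2m$) with a spin structure. Let $\nabla$ be the Levi-Civita connection and $\Omega=g(\cdot,J\cdot)$ the Kähler form. Vectors and covectors are identified by $g$, so $(J\alpha)(Y)=-\alpha(JY)$ for a 1-form $\alpha$; 2-forms carry the inner product $(\xi,\eta)=\sum_{a<b}\xi(e_a,e_b)\,\eta(e_a,e_b)$ ($(e_a)$ an orthonormal basis). *The connection $\nabla^{CH}$.* On $\mathcal E=\Lambda^2_JM\oplus T^*M\oplus\mathbb R$, where $\Lambda^2_JM$ is the bundle of $J$-invariant 2-forms, put $$\nabla^{CH}_X\begin{pmatrix}\xi\\ \alpha\\ u\end{pmatrix}=\begin{pmatrix}\nabla_X\xi+\tfrac12\,(X\wedge\alpha+JX\wedge J\alpha)\\ \nabla_X\alpha+2\,\iota_X(\xi+u\,\Omega)\\ du(X)+(J\alpha)(X)\end{pmatrix}.$$ Let $\mathcal N$ be the space of smooth $\nabla^{CH}$-parallel sections of $\mathcal E$ and $\mathcal N_0=\{(\xi,\alpha,u)\in\mathcal N : (\xi,\Omega)=u\}$.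 *Kählerian Killing spinors.* Let $\Sigma$ be the complex spinor bundle, with Clifford multiplication satisfying $X\cdot X\cdot\psi=-|X|^2\psi$, its Hermitian product $(\cdot,\cdot)$ (linear in the first variable), and the spin connection $\nabla$ induced by the Levi-Civita connection. Let $\Sigma=\bigoplus_{k=0}^m\Sigma_k$ be the orthogonal decomposition in which $\Omega$ acts on $\Sigma_k$, by Clifford multiplication, as $i(m-2k)$, and let $\psi_k$ be the component of $\psi$ in $\Sigma_k$. Write $X^{1,0}=\frac12(X-iJX)$ and $X^{0,1}=\frac12(X+iJX)$. An (imaginary) Kählerian Killing spinor is a smooth section $\varphi=\varphi_{l-1}+\varphi_l$ of $\Sigma_{l-1}\oplus\Sigma_l$ such that, for every vector $X$, $$\nabla_X\varphi+i\,X^{1,0}\cdot\varphi_{l-1}+i\,X^{0,1}\cdot\varphi_l=0.$$ Let $\mathcal K$ be the space of Kählerian Killing spinors. For $\varphi\in\mathcal K$ put $\tilde\varphi=\varphi_{l-1}-\varphi_l$ and $$u_\varphi=|\varphi|^2,\qquad \alpha_\varphi=J\,du_\varphi,\qquad \xi_\varphi(X,Y)=\operatorname{Im}\,(X\cdot Y\cdot\tilde\varphi,\varphi).$$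 **Statement.** For every $\varphi\in\mathcal K$, the triple $Q(\varphi)=(\xi_\varphi,\alpha_\varphi,u_\varphi)$ belongs to $\mathcal N_0$: $\xi_\varphi$ is a $J$-invariant 2-form, $(\xi_\varphi,\alpha_\varphi,u_\varphi)$ is a smooth section of $\mathcal E$ with $\nabla^{CH}(\xi_\varphi,\alpha_\varphi,u_\varphi)=0$, and $(\xi_\varphi,\Omega)=u_\varphi=|\varphi|^2$. Hence $Q$ is a map $\mathcal K\to\mathcal N_0$. -/

import Mathlib

open Bundle
open scoped Manifold ContDiff InnerProductSpace

noncomputable section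

namespace KahlerSpin

/-! ### The complex spin representation of `Spin(2m)` -/

/-- The spinor module `Λ(ℂ^m)` of complex dimension `2^m`, with the Hermitian product for which the
monomials `e_A = e_{a_1} ∧ ⋯ ∧ e_{a_k}`, `A = {a_1 < ⋯ < a_k}`, are orthonormal; `ψ A` is the
coefficient of `e_A`. -/
abbrev SpinorModule (m : ℕ) : Type := EuclideanSpace ℂ (Finset (Fin m))

/-- The quadratic form `v ↦ -|v|²` on `ℝ^{2m}`, so that `v * v = -|v|²` in its Clifford algebra. -/
def cliffordForm (m : ℕ) : QuadraticForm ℝ (Fin m ⊕ Fin m → ℝ) :=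
  QuadraticMap.weightedSumSquares ℝ (fun _ => (-1 : ℝ))

/-- `(-1)` to the number of elements of `A` below `k`. -/
def koszulSign {m : ℕ} (k : Fin m) (A : Finset (Fin m)) : ℂ :=
  (-1) ^ (A.filter (fun j => j < k)).card

/-- Exterior multiplication `e_k ∧ ·`. -/
def wedgeOp {m : ℕ} (k : Fin m) : Module.End ℂ (SpinorModule m) where
  toFun ψ := WithLp.toLp 2 fun A => if k ∈ A then koszulSign k A * ψ (A.erase k) else 0
  map_add' ψ χ := by
    ext A
    by_cases h : k ∈ A <;> simp [h, mul_add]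
  map_smul' c ψ := by
    ext A
    by_cases h : k ∈ A <;> simp [h, mul_left_comm]

/-- Contraction by `e_k`, the adjoint of `wedgeOp k`. -/
def contractOp {m : ℕ} (k : Fin m) : Module.End ℂ (SpinorModule m) where
  toFun ψ := WithLp.toLp 2 fun A => if k ∈ A then 0 else koszulSign k A * ψ (insert k A)
  map_add' ψ χ := by
    ext A
    by_cases h : k ∈ A <;> simp [h, mul_add]
  map_smul' c ψ := by
    ext A
    by_cases h : k ∈ A <;> simp [h, mul_left_comm]

/-- The Clifford action of the standard basis of `ℝ^{2m} = ℂ^m`: `Sum.inl k` is the real direction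
`e_k`, acting by `e_k ∧ · - e_k ⌟ ·`, and `Sum.inr k` is the direction `i e_k`. -/
def gamma {m : ℕ} : Fin m ⊕ Fin m → Module.End ℂ (SpinorModule m)
  | Sum.inl k => wedgeOp k - contractOp k
  | Sum.inr k => Complex.I • (wedgeOp k + contractOp k)

/-- Clifford multiplication of vectors of `ℝ^{2m}` on spinors. -/
def cliffordMul (m : ℕ) : (Fin m ⊕ Fin m → ℝ) →ₗ[ℝ] Module.End ℂ (SpinorModule m) :=
  Fintype.linearCombination ℝ gamma

theorem koszulSign_mul_self {m : ℕ} (k : Fin m) (A : Finset (Fin m)) :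
    koszulSign k A * koszulSign k A = 1 := by
  simp [koszulSign, ← mul_pow]

theorem koszulSign_insert {m : ℕ} {j k : Fin m} {A : Finset (Fin m)} (hj : j ∉ A) :
    koszulSign k (insert j A) = if j < k then -koszulSign k A else koszulSign k A := by
  unfold koszulSign
  rw [Finset.filter_insert]
  split_ifs with h
  · rw [Finset.card_insert_of_notMem (by simp [hj]), pow_succ]; ring
  · rfl

theorem koszulSign_erase {m : ℕ} {j k : Fin m} {A : Finset (Fin m)} (hj : j ∈ A) :
    koszulSign k (A.erase j) = if j < k then -koszulSign k A else koszulSign k A := by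
  have h := koszulSign_insert (k := k) (Finset.notMem_erase j A)
  rw [Finset.insert_erase hj] at h
  split_ifs at h ⊢ with hjk
  · rw [h, neg_neg]
  · exact h.symm

theorem wedgeOp_anticomm {m : ℕ} (j k : Fin m) :
    wedgeOp j * wedgeOp k + wedgeOp k * wedgeOp j = 0 := by
  ext1 ψ
  ext A
  simp only [LinearMap.add_apply, Module.End.mul_apply, PiLp.add_apply, wedgeOp, LinearMap.coe_mk,
    AddHom.coe_mk, LinearMap.zero_apply, PiLp.zero_apply]
  by_cases hj : j ∈ A <;> by_cases hk : k ∈ A <;> rcases lt_trichotomy j k with h | h | h <;>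
    simp_all [koszulSign_erase, Finset.erase_right_comm, ne_of_gt, ne_of_lt, not_lt_of_gt] <;>
    ring

theorem contractOp_anticomm {m : ℕ} (j k : Fin m) :
    contractOp j * contractOp k + contractOp k * contractOp j = 0 := by
  ext1 ψ
  ext A
  simp only [LinearMap.add_apply, Module.End.mul_apply, PiLp.add_apply, contractOp,
    LinearMap.coe_mk, AddHom.coe_mk, LinearMap.zero_apply, PiLp.zero_apply]
  by_cases hj : j ∈ A <;> by_cases hk : k ∈ A <;> rcases lt_trichotomy j k with h | h | h <;>
    simp_all [koszulSign_insert, Finset.insert_comm, ne_of_gt, ne_of_lt, not_lt_of_gt] <;>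
    ring

theorem wedgeOp_contractOp_anticomm {m : ℕ} (j k : Fin m) :
    wedgeOp j * contractOp k + contractOp k * wedgeOp j = if j = k then 1 else 0 := by
  ext1 ψ
  ext A
  rcases lt_trichotomy j k with h | h | h
  · have hne := h.ne
    have hne' := h.ne'
    have hlt := h.not_gt
    by_cases hj : j ∈ A <;> by_cases hk : k ∈ A <;>
      simp [wedgeOp, contractOp, koszulSign_insert, koszulSign_erase, hne, hne', hj, hk, h, hlt,
        Finset.erase_insert_of_ne hne', mul_left_comm]
  · subst h
    by_cases hj : j ∈ A <;>
      simp [wedgeOp, contractOp, koszulSign_insert, koszulSign_erase, hj, ← mul_assoc,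
        koszulSign_mul_self]
  · have hne := h.ne
    have hne' := h.ne'
    have hlt := h.not_gt
    by_cases hj : j ∈ A <;> by_cases hk : k ∈ A <;>
      simp [wedgeOp, contractOp, koszulSign_insert, koszulSign_erase, hne, hne', hj, hk, h, hlt,
        Finset.erase_insert_of_ne hne, mul_left_comm]

theorem gamma_anticomm {m : ℕ} (a b : Fin m ⊕ Fin m) :
    (gamma a * gamma b + gamma b * gamma a : Module.End ℂ (SpinorModule m)) =
      if a = b then -2 else 0 := by
  rcases a with j | j <;> rcases b with k | k
  · have h1 := wedgeOp_anticomm j k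
    have h2 := contractOp_anticomm j k
    have h3 := wedgeOp_contractOp_anticomm j k
    have h4 := wedgeOp_contractOp_anticomm k j
    simp only [eq_comm (a := k)] at h4
    have : (gamma (Sum.inl j) * gamma (Sum.inl k) + gamma (Sum.inl k) * gamma (Sum.inl j) :
        Module.End ℂ (SpinorModule m)) =
        (wedgeOp j * wedgeOp k + wedgeOp k * wedgeOp j) +
        (contractOp j * contractOp k + contractOp k * contractOp j) -
        (wedgeOp j * contractOp k + contractOp k * wedgeOp j) -
        (wedgeOp k * contractOp j + contractOp j * wedgeOp k) := by
      simp only [gamma]; noncomm_ring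
    rw [this, h1, h2, h3, h4]
    by_cases h : j = k <;> simp [h]
    norm_num
  · have h1 := wedgeOp_anticomm j k
    have h2 := contractOp_anticomm j k
    have h3 := wedgeOp_contractOp_anticomm j k
    have h4 := wedgeOp_contractOp_anticomm k j
    simp only [eq_comm (a := k)] at h4
    have : (gamma (Sum.inl j) * gamma (Sum.inr k) + gamma (Sum.inr k) * gamma (Sum.inl j) :
        Module.End ℂ (SpinorModule m)) = Complex.I • (
        (wedgeOp j * wedgeOp k + wedgeOp k * wedgeOp j) -
        (contractOp j * contractOp k + contractOp k * contractOp j) +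
        (wedgeOp j * contractOp k + contractOp k * wedgeOp j) -
        (wedgeOp k * contractOp j + contractOp j * wedgeOp k)) := by
      simp only [gamma, mul_smul_comm, smul_mul_assoc, ← smul_add]
      congr 1; noncomm_ring
    rw [this, h1, h2, h3, h4]
    simp
  · have h1 := wedgeOp_anticomm j k
    have h2 := contractOp_anticomm j k
    have h3 := wedgeOp_contractOp_anticomm j k
    have h4 := wedgeOp_contractOp_anticomm k j
    simp only [eq_comm (a := k)] at h4
    have : (gamma (Sum.inr j) * gamma (Sum.inl k) + gamma (Sum.inl k) * gamma (Sum.inr j) :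
        Module.End ℂ (SpinorModule m)) = Complex.I • (
        (wedgeOp j * wedgeOp k + wedgeOp k * wedgeOp j) -
        (contractOp j * contractOp k + contractOp k * contractOp j) -
        (wedgeOp j * contractOp k + contractOp k * wedgeOp j) +
        (wedgeOp k * contractOp j + contractOp j * wedgeOp k)) := by
      simp only [gamma, mul_smul_comm, smul_mul_assoc, ← smul_add]
      congr 1; noncomm_ring
    rw [this, h1, h2, h3, h4]
    simp
  · have h1 := wedgeOp_anticomm j k
    have h2 := contractOp_anticomm j k
    have h3 := wedgeOp_contractOp_anticomm j k
    have h4 := wedgeOp_contractOp_anticomm k j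
    simp only [eq_comm (a := k)] at h4
    have : (gamma (Sum.inr j) * gamma (Sum.inr k) + gamma (Sum.inr k) * gamma (Sum.inr j) :
        Module.End ℂ (SpinorModule m)) = -(
        (wedgeOp j * wedgeOp k + wedgeOp k * wedgeOp j) +
        (contractOp j * contractOp k + contractOp k * contractOp j) +
        (wedgeOp j * contractOp k + contractOp k * wedgeOp j) +
        (wedgeOp k * contractOp j + contractOp j * wedgeOp k)) := by
      simp only [gamma, mul_smul_comm, smul_mul_assoc, smul_smul, Complex.I_mul_I, neg_smul,
        one_smul]
      noncomm_ring
    rw [this, h1, h2, h3, h4]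
    by_cases h : j = k <;> simp [h]
    norm_num

theorem cliffordMul_mul_self {m : ℕ} (v : Fin m ⊕ Fin m → ℝ) :
    cliffordMul m v * cliffordMul m v =
      algebraMap ℝ (Module.End ℂ (SpinorModule m)) (cliffordForm m v) := by
  have hsq : cliffordMul m v * cliffordMul m v =
      ∑ a, ∑ b, (v a * v b) • (gamma a * gamma b : Module.End ℂ (SpinorModule m)) := by
    simp only [cliffordMul, Fintype.linearCombination_apply, Finset.sum_mul_sum,
      smul_mul_smul_comm]
  have h2 : (2 : ℝ) • (cliffordMul m v * cliffordMul m v) =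
      (2 : ℝ) • algebraMap ℝ (Module.End ℂ (SpinorModule m)) (cliffordForm m v) := by
    calc (2 : ℝ) • (cliffordMul m v * cliffordMul m v)
        = ∑ a, ∑ b, (v a * v b) •
            (gamma a * gamma b + gamma b * gamma a : Module.End ℂ (SpinorModule m)) := by
          simp only [smul_add, Finset.sum_add_distrib]
          rw [two_smul, hsq]
          congr 1
          rw [Finset.sum_comm]
          exact Finset.sum_congr rfl fun a _ => Finset.sum_congr rfl fun b _ => by
            rw [mul_comm (v a)]
      _ = _ := by
          simp only [gamma_anticomm, smul_ite, smul_zero, Finset.sum_ite_eq, Finset.mem_univ,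
            if_true, cliffordForm, QuadraticMap.weightedSumSquares_apply, Algebra.algebraMap_eq_smul_one,
            Finset.sum_smul, Finset.smul_sum]
          refine Finset.sum_congr rfl fun a _ => ?_
          rw [show (-2 : Module.End ℂ (SpinorModule m)) = (-2 : ℝ) • 1 by
            rw [neg_smul, two_smul]; norm_num [one_add_one_eq_two], smul_smul, smul_smul]
          congr 1
          simp only [smul_eq_mul]
          ring
  exact smul_right_injective _ two_ne_zero h2

/-- The spin representation, on the whole Clifford algebra. -/
def spinRep (m : ℕ) : CliffordAlgebra (cliffordForm m) →ₐ[ℝ] Module.End ℂ (SpinorModule m) :=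
  CliffordAlgebra.lift (cliffordForm m) ⟨cliffordMul m, cliffordMul_mul_self⟩

/-- The operator on spinors given by an element of the spin group, as a continuous real-linear
map. -/
def spinOp {m : ℕ} (g : spinGroup (cliffordForm m)) : SpinorModule m →L[ℝ] SpinorModule m :=
  LinearMap.toContinuousLinearMap ((spinRep m (g : CliffordAlgebra _)).restrictScalars ℝ)

theorem spinOp_mul_apply {m : ℕ} (g h : spinGroup (cliffordForm m)) (v : SpinorModule m) :
    spinOp (g * h) v = spinOp g (spinOp h v) := by
  simp [spinOp]

theorem spinOp_one_apply {m : ℕ} (v : SpinorModule m) :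
    spinOp (1 : spinGroup (cliffordForm m)) v = v := by
  simp [spinOp]

section Manifold

variable {m : ℕ} {M : Type*} [TopologicalSpace M]
  [ChartedSpace (EuclideanSpace ℝ (Fin (2 * m))) M] [IsManifold (𝓡 (2 * m)) ∞ M]
  [RiemannianBundle (fun x : M => TangentSpace (𝓡 (2 * m)) x)]
  [IsContMDiffRiemannianBundle (𝓡 (2 * m)) ∞ (EuclideanSpace ℝ (Fin (2 * m)))
    (fun x : M => TangentSpace (𝓡 (2 * m)) x)]

instance (x : M) : FiniteDimensional ℝ (TangentSpace (𝓡 (2 * m)) x) :=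
  inferInstanceAs (FiniteDimensional ℝ (EuclideanSpace ℝ (Fin (2 * m))))

instance : IsContMDiffRiemannianBundle (𝓡 (2 * m)) 1 (EuclideanSpace ℝ (Fin (2 * m)))
    (TangentSpace (𝓡 (2 * m)) : M → Type _) :=
  IsContMDiffRiemannianBundle.of_le (n := ∞)
    (h := ‹IsContMDiffRiemannianBundle (𝓡 (2 * m)) ∞ (EuclideanSpace ℝ (Fin (2 * m)))
      (fun x : M => TangentSpace (𝓡 (2 * m)) x)›) (mod_cast le_top)

/-! ### Kähler manifolds -/

/-- `nabla` is the Levi-Civita connection: it is torsion-free and metric. -/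
def IsLeviCivita (nabla : CovariantDerivative (𝓡 (2 * m)) (EuclideanSpace ℝ (Fin (2 * m)))
    (TangentSpace (𝓡 (2 * m)) : M → Type _)) : Prop :=
  nabla.torsion = 0 ∧ nabla.IsMetricCompatible

/-- The smooth field of endomorphisms `J` is an orthogonal almost complex structure, parallel for
the Levi-Civita connection `nabla`: `(M, g, J)` is Kähler. -/
structure IsKahler (nabla : CovariantDerivative (𝓡 (2 * m)) (EuclideanSpace ℝ (Fin (2 * m)))
      (TangentSpace (𝓡 (2 * m)) : M → Type _))
    (J : ∀ x : M, TangentSpace (𝓡 (2 * m)) x →L[ℝ] TangentSpace (𝓡 (2 * m)) x) : Prop where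
  contMDiff : ContMDiff (𝓡 (2 * m)) ((𝓡 (2 * m)).prod
    𝓘(ℝ, EuclideanSpace ℝ (Fin (2 * m)) →L[ℝ] EuclideanSpace ℝ (Fin (2 * m)))) ∞
    (fun x => TotalSpace.mk' (EuclideanSpace ℝ (Fin (2 * m)) →L[ℝ] EuclideanSpace ℝ (Fin (2 * m)))
      x (J x))
  apply_apply : ∀ x v, J x (J x v) = -v
  inner_apply : ∀ x v w, ⟪J x v, J x w⟫_ℝ = ⟪v, w⟫_ℝ
  parallel : ∀ (Y : ∀ x : M, TangentSpace (𝓡 (2 * m)) x) (x : M),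
    MDifferentiableAt (𝓡 (2 * m)) (𝓡 (2 * m)).tangent
      (fun y => (⟨y, Y y⟩ : TangentBundle (𝓡 (2 * m)) M)) x →
    ∀ v, nabla (fun y => J y (Y y)) x v = J x (nabla Y x v)

/-! ### Spin structures and spinors -/

variable (m M) in
/-- A spin structure on `M`, given by local oriented orthonormal frames `frame i` on an open cover
and a cocycle `lift` with values in `Spin(2m)` lifting the changes of frames:
`frame j = frame i ∘ Ad (lift i j)`, where `Ad(g) v = g v g⁻¹`. -/
structure SpinStructure (ι : Type*) where
  baseSet : ι → Set M
  isOpen_baseSet : ∀ i, IsOpen (baseSet i)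
  indexAt : M → ι
  mem_baseSet_at : ∀ x, x ∈ baseSet (indexAt x)
  frame : ι → Fin m ⊕ Fin m → ∀ x : M, TangentSpace (𝓡 (2 * m)) x
  contMDiffOn_frame : ∀ i a, ContMDiffOn (𝓡 (2 * m)) (𝓡 (2 * m)).tangent ∞
    (fun x => (⟨x, frame i a x⟩ : TangentBundle (𝓡 (2 * m)) M)) (baseSet i)
  orthonormal_frame : ∀ i, ∀ x ∈ baseSet i, Orthonormal ℝ (fun a => frame i a x)
  lift : ι → ι → M → spinGroup (cliffordForm m)
  contMDiffOn_lift : ∀ i j, ContMDiffOn (𝓡 (2 * m))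
    𝓘(ℝ, SpinorModule m →L[ℝ] SpinorModule m) ∞ (fun x => spinOp (lift i j x))
    (baseSet i ∩ baseSet j)
  lift_self : ∀ i, ∀ x ∈ baseSet i, lift i i x = 1
  lift_mul : ∀ i j k, ∀ x ∈ baseSet i ∩ baseSet j ∩ baseSet k,
    lift i j x * lift j k x = lift i k x
  lift_cover : ∀ i j, ∀ x ∈ baseSet i ∩ baseSet j, ∀ b,
    (lift i j x : CliffordAlgebra (cliffordForm m)) *
        CliffordAlgebra.ι (cliffordForm m) (Pi.single b 1) * star (lift i j x) =
      CliffordAlgebra.ι (cliffordForm m) (fun a => ⟪frame i a x, frame j b x⟫_ℝ)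

variable {ι : Type*}

/-- The spinor bundle, associated with the spin representation. The fibre `s.spinorBundle.Fiber x`
is a copy of `SpinorModule m`, through the trivialization given by the frame `s.indexAt x`. -/
def SpinStructure.spinorBundle (s : SpinStructure m M ι) :
    VectorBundleCore ℝ M (SpinorModule m) ι where
  baseSet := s.baseSet
  isOpen_baseSet := s.isOpen_baseSet
  indexAt := s.indexAt
  mem_baseSet_at := s.mem_baseSet_at
  coordChange i j x := spinOp (s.lift j i x)
  coordChange_self i x hx v := by rw [s.lift_self i x hx, spinOp_one_apply]
  continuousOn_coordChange i j := by
    rw [Set.inter_comm]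
    exact (s.contMDiffOn_lift j i).continuousOn
  coordChange_comp i j k x hx v := by
    rw [← spinOp_mul_apply, s.lift_mul k j i x ⟨⟨hx.2, hx.1.2⟩, hx.1.1⟩]

instance (s : SpinStructure m M ι) : s.spinorBundle.IsContMDiff (𝓡 (2 * m)) ∞ where
  contMDiffOn_coordChange i j := by
    rw [Set.inter_comm]
    exact s.contMDiffOn_lift j i

/-- An element of the fibre of the spinor bundle at `x`, read in the frame `s.indexAt x`. -/
def SpinStructure.read (s : SpinStructure m M ι) {x : M} (ψ : s.spinorBundle.Fiber x) :
    SpinorModule m :=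
  ψ

/-- Clifford multiplication by a tangent vector at `x`, on the fibre of the spinor bundle. -/
def SpinStructure.clifford (s : SpinStructure m M ι) (x : M) :
    TangentSpace (𝓡 (2 * m)) x →ₗ[ℝ] Module.End ℂ (SpinorModule m) :=
  cliffordMul m ∘ₗ LinearMap.pi fun a => innerₗ _ (s.frame (s.indexAt x) a x)

/-- The spin connection: in the frame `e = s.frame i`, where `i = s.indexAt x`,
`∇_v φ = dφ(v) + 1/4 ∑_{a,b} g(∇_v e_a, e_b) e_a · e_b · φ`. -/
def SpinStructure.covDeriv (s : SpinStructure m M ι)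
    (nabla : CovariantDerivative (𝓡 (2 * m)) (EuclideanSpace ℝ (Fin (2 * m)))
      (TangentSpace (𝓡 (2 * m)) : M → Type _))
    (φ : ∀ x, s.spinorBundle.Fiber x) (x : M) (v : TangentSpace (𝓡 (2 * m)) x) : SpinorModule m :=
  mvfderiv (𝓡 (2 * m))
      (fun y => s.spinorBundle.coordChange (s.indexAt y) (s.indexAt x) y (φ y)) x v +
    (1 / 4 : ℝ) • ∑ a, ∑ b,
      ⟪nabla (s.frame (s.indexAt x) a) x v, s.frame (s.indexAt x) b x⟫_ℝ •
        (gamma a * gamma b : Module.End ℂ (SpinorModule m)) (s.read (φ x))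

/-- The Clifford action of the Kähler form `Ω = g(·, J ·)` on spinors; in any orthonormal frame it
is `1/2 ∑_{a,b} Ω(e_a, e_b) e_a · e_b`. -/
def SpinStructure.kahlerAction (s : SpinStructure m M ι)
    (J : ∀ x : M, TangentSpace (𝓡 (2 * m)) x →L[ℝ] TangentSpace (𝓡 (2 * m)) x) (x : M) :
    Module.End ℂ (SpinorModule m) :=
  (1 / 2 : ℝ) • ∑ a, ∑ b,
    ⟪s.frame (s.indexAt x) a x, J x (s.frame (s.indexAt x) b x)⟫_ℝ •
      (s.clifford x (s.frame (s.indexAt x) a x) * s.clifford x (s.frame (s.indexAt x) b x))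

/-- The subspace `Σ_k` of spinors at `x`, on which the Kähler form acts as `i (m - 2k)`. -/
def SpinStructure.degreePart (s : SpinStructure m M ι)
    (J : ∀ x : M, TangentSpace (𝓡 (2 * m)) x →L[ℝ] TangentSpace (𝓡 (2 * m)) x) (k : ℕ) (x : M) :
    Submodule ℂ (SpinorModule m) :=
  Module.End.eigenspace (s.kahlerAction J x) (Complex.I * ((m : ℂ) - 2 * (k : ℂ)))

/-- The component `ψ_k` of a spinor in the orthogonal decomposition `Σ = ⨁ Σ_k`. -/
def SpinStructure.component (s : SpinStructure m M ι)
    (J : ∀ x : M, TangentSpace (𝓡 (2 * m)) x →L[ℝ] TangentSpace (𝓡 (2 * m)) x) (k : ℕ) (x : M)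
    (ψ : SpinorModule m) : SpinorModule m :=
  (s.degreePart J k x).starProjection ψ

/-- Clifford multiplication by `v^{1,0} = (v - i J v) / 2`. -/
def SpinStructure.clifford10 (s : SpinStructure m M ι)
    (J : ∀ x : M, TangentSpace (𝓡 (2 * m)) x →L[ℝ] TangentSpace (𝓡 (2 * m)) x) (x : M)
    (v : TangentSpace (𝓡 (2 * m)) x) : Module.End ℂ (SpinorModule m) :=
  (1 / 2 : ℂ) • (s.clifford x v - Complex.I • s.clifford x (J x v))

/-- Clifford multiplication by `v^{0,1} = (v + i J v) / 2`. -/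
def SpinStructure.clifford01 (s : SpinStructure m M ι)
    (J : ∀ x : M, TangentSpace (𝓡 (2 * m)) x →L[ℝ] TangentSpace (𝓡 (2 * m)) x) (x : M)
    (v : TangentSpace (𝓡 (2 * m)) x) : Module.End ℂ (SpinorModule m) :=
  (1 / 2 : ℂ) • (s.clifford x v + Complex.I • s.clifford x (J x v))

/-- The connection `∇_v ψ + i c(v^{1,0}) ψ_{l-1} + i c(v^{0,1}) ψ_l` on the spinor bundle. -/
def SpinStructure.killingCovDeriv (s : SpinStructure m M ι)
    (nabla : CovariantDerivative (𝓡 (2 * m)) (EuclideanSpace ℝ (Fin (2 * m)))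
      (TangentSpace (𝓡 (2 * m)) : M → Type _))
    (J : ∀ x : M, TangentSpace (𝓡 (2 * m)) x →L[ℝ] TangentSpace (𝓡 (2 * m)) x) (l : ℕ)
    (φ : ∀ x, s.spinorBundle.Fiber x) (x : M) (v : TangentSpace (𝓡 (2 * m)) x) : SpinorModule m :=
  s.covDeriv nabla φ x v + Complex.I • s.clifford10 J x v (s.component J (l - 1) x (s.read (φ x))) +
    Complex.I • s.clifford01 J x v (s.component J l x (s.read (φ x)))

/-- The space `𝒦` of imaginary Kählerian Killing spinors: the smooth sections of `Σ_{l-1} ⊕ Σ_l`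
that are parallel for `killingCovDeriv`. -/
def SpinStructure.killingSpinors (s : SpinStructure m M ι)
    (nabla : CovariantDerivative (𝓡 (2 * m)) (EuclideanSpace ℝ (Fin (2 * m)))
      (TangentSpace (𝓡 (2 * m)) : M → Type _))
    (J : ∀ x : M, TangentSpace (𝓡 (2 * m)) x →L[ℝ] TangentSpace (𝓡 (2 * m)) x) (l : ℕ) :
    Set (∀ x, s.spinorBundle.Fiber x) :=
  {φ | ContMDiff (𝓡 (2 * m)) ((𝓡 (2 * m)).prod 𝓘(ℝ, SpinorModule m)) ∞
        (fun x => TotalSpace.mk' (SpinorModule m) x (φ x)) ∧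
      (∀ x, s.read (φ x) ∈ s.degreePart J (l - 1) x ⊔ s.degreePart J l x) ∧
      ∀ x v, s.killingCovDeriv nabla J l φ x v = 0}

/-! ### The complex hyperbolic connection -/

variable (m M) in
/-- Triples `(ξ, α, u)` consisting of a field of bilinear forms, a field of linear forms and a
function. -/
structure HypField where
  form : ∀ x : M, TangentSpace (𝓡 (2 * m)) x →L[ℝ] TangentSpace (𝓡 (2 * m)) x →L[ℝ] ℝ
  oneForm : ∀ x : M, TangentSpace (𝓡 (2 * m)) x →L[ℝ] ℝ
  fn : M → ℝ

/-- `σ = (ξ, α, u)` is a smooth section of `ℰ = Λ²_J M ⊕ T*M ⊕ ℝ`, where `Λ²_J M` is the bundle of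
`J`-invariant 2-forms. -/
structure HypField.IsSection
    (J : ∀ x : M, TangentSpace (𝓡 (2 * m)) x →L[ℝ] TangentSpace (𝓡 (2 * m)) x)
    (σ : HypField m M) : Prop where
  form_self : ∀ x v, σ.form x v v = 0
  form_invariant : ∀ x v w, σ.form x (J x v) (J x w) = σ.form x v w
  contMDiff_form : ContMDiff (𝓡 (2 * m)) ((𝓡 (2 * m)).prod 𝓘(ℝ, EuclideanSpace ℝ (Fin (2 * m)) →L[ℝ]
      EuclideanSpace ℝ (Fin (2 * m)) →L[ℝ] ℝ)) ∞
    (fun x => TotalSpace.mk' (EuclideanSpace ℝ (Fin (2 * m)) →L[ℝ]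
      EuclideanSpace ℝ (Fin (2 * m)) →L[ℝ] ℝ) x (σ.form x))
  contMDiff_oneForm : ContMDiff (𝓡 (2 * m))
    ((𝓡 (2 * m)).prod 𝓘(ℝ, EuclideanSpace ℝ (Fin (2 * m)) →L[ℝ] ℝ)) ∞
    (fun x => TotalSpace.mk' (EuclideanSpace ℝ (Fin (2 * m)) →L[ℝ] ℝ) x (σ.oneForm x))
  contMDiff_fn : ContMDiff (𝓡 (2 * m)) 𝓘(ℝ, ℝ) ∞ σ.fn

/-- The covariant derivative `(∇_v α)(w)` of a 1-form, computed with an extension of `w`. -/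
def covDerivOneForm (nabla : CovariantDerivative (𝓡 (2 * m)) (EuclideanSpace ℝ (Fin (2 * m)))
      (TangentSpace (𝓡 (2 * m)) : M → Type _))
    (α : ∀ x : M, TangentSpace (𝓡 (2 * m)) x →L[ℝ] ℝ) (x : M)
    (v w : TangentSpace (𝓡 (2 * m)) x) : ℝ :=
  let W : ∀ y : M, TangentSpace (𝓡 (2 * m)) y :=
    FiberBundle.extend (EuclideanSpace ℝ (Fin (2 * m))) w
  mvfderiv (𝓡 (2 * m)) (fun y => α y (W y)) x v - α x (nabla W x v)

/-- The covariant derivative `(∇_v ξ)(w₁, w₂)` of a bilinear form, computed with extensions of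
`w₁` and `w₂`. -/
def covDerivForm (nabla : CovariantDerivative (𝓡 (2 * m)) (EuclideanSpace ℝ (Fin (2 * m)))
      (TangentSpace (𝓡 (2 * m)) : M → Type _))
    (ξ : ∀ x : M, TangentSpace (𝓡 (2 * m)) x →L[ℝ] TangentSpace (𝓡 (2 * m)) x →L[ℝ] ℝ) (x : M)
    (v w₁ w₂ : TangentSpace (𝓡 (2 * m)) x) : ℝ :=
  let W₁ : ∀ y : M, TangentSpace (𝓡 (2 * m)) y :=
    FiberBundle.extend (EuclideanSpace ℝ (Fin (2 * m))) w₁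
  let W₂ : ∀ y : M, TangentSpace (𝓡 (2 * m)) y :=
    FiberBundle.extend (EuclideanSpace ℝ (Fin (2 * m))) w₂
  mvfderiv (𝓡 (2 * m)) (fun y => ξ y (W₁ y) (W₂ y)) x v - ξ x (nabla W₁ x v) w₂ -
    ξ x w₁ (nabla W₂ x v)

/-- The action of `J` on 1-forms, through the metric identification of vectors and covectors:
`(J α)(w) = -α(J w)`. -/
def jOneForm (J : ∀ x : M, TangentSpace (𝓡 (2 * m)) x →L[ℝ] TangentSpace (𝓡 (2 * m)) x)
    (α : ∀ x : M, TangentSpace (𝓡 (2 * m)) x →L[ℝ] ℝ) (x : M) : TangentSpace (𝓡 (2 * m)) x →L[ℝ] ℝ :=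
  -(α x ∘L J x)

/-- The Kähler form `Ω = g(·, J ·)`. -/
def kahlerForm (J : ∀ x : M, TangentSpace (𝓡 (2 * m)) x →L[ℝ] TangentSpace (𝓡 (2 * m)) x) (x : M)
    (v w : TangentSpace (𝓡 (2 * m)) x) : ℝ :=
  ⟪v, J x w⟫_ℝ

/-- The value of the 2-form `v ∧ β` at `(w₁, w₂)`, where the vector `v` is identified with the
covector `g(v, ·)`. -/
def wedgeVec {x : M} (v : TangentSpace (𝓡 (2 * m)) x) (β : TangentSpace (𝓡 (2 * m)) x →L[ℝ] ℝ)
    (w₁ w₂ : TangentSpace (𝓡 (2 * m)) x) : ℝ :=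
  ⟪v, w₁⟫_ℝ * β w₂ - ⟪v, w₂⟫_ℝ * β w₁

/-- The first component of `∇^{CH}_v (ξ, α, u)`, namely `∇_v ξ + 1/2 (v ∧ α + J v ∧ J α)`. -/
def HypField.covDerivFst (nabla : CovariantDerivative (𝓡 (2 * m)) (EuclideanSpace ℝ (Fin (2 * m)))
      (TangentSpace (𝓡 (2 * m)) : M → Type _))
    (J : ∀ x : M, TangentSpace (𝓡 (2 * m)) x →L[ℝ] TangentSpace (𝓡 (2 * m)) x)
    (σ : HypField m M) (x : M) (v w₁ w₂ : TangentSpace (𝓡 (2 * m)) x) : ℝ :=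
  covDerivForm nabla σ.form x v w₁ w₂ +
    1 / 2 * (wedgeVec v (σ.oneForm x) w₁ w₂ + wedgeVec (J x v) (jOneForm J σ.oneForm x) w₁ w₂)

/-- The second component of `∇^{CH}_v (ξ, α, u)`, namely `∇_v α + 2 ι_v (ξ + u Ω)`. -/
def HypField.covDerivSnd (nabla : CovariantDerivative (𝓡 (2 * m)) (EuclideanSpace ℝ (Fin (2 * m)))
      (TangentSpace (𝓡 (2 * m)) : M → Type _))
    (J : ∀ x : M, TangentSpace (𝓡 (2 * m)) x →L[ℝ] TangentSpace (𝓡 (2 * m)) x)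
    (σ : HypField m M) (x : M) (v w : TangentSpace (𝓡 (2 * m)) x) : ℝ :=
  covDerivOneForm nabla σ.oneForm x v w + 2 * (σ.form x v w + σ.fn x * kahlerForm J x v w)

/-- The third component of `∇^{CH}_v (ξ, α, u)`, namely `du(v) + (J α)(v)`. -/
def HypField.covDerivThd
    (J : ∀ x : M, TangentSpace (𝓡 (2 * m)) x →L[ℝ] TangentSpace (𝓡 (2 * m)) x)
    (σ : HypField m M) (x : M) (v : TangentSpace (𝓡 (2 * m)) x) : ℝ :=
  mvfderiv (𝓡 (2 * m)) σ.fn x v + jOneForm J σ.oneForm x v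

/-- The space `𝒩` of `∇^{CH}`-parallel sections of `ℰ`. -/
def parallelSections (nabla : CovariantDerivative (𝓡 (2 * m)) (EuclideanSpace ℝ (Fin (2 * m)))
      (TangentSpace (𝓡 (2 * m)) : M → Type _))
    (J : ∀ x : M, TangentSpace (𝓡 (2 * m)) x →L[ℝ] TangentSpace (𝓡 (2 * m)) x) :
    Set (HypField m M) :=
  {σ | σ.IsSection J ∧ ∀ x v, (∀ w₁ w₂, σ.covDerivFst nabla J x v w₁ w₂ = 0) ∧
    (∀ w, σ.covDerivSnd nabla J x v w = 0) ∧ σ.covDerivThd J x v = 0}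

/-- The inner product `∑_{a < b} ξ(e_a, e_b) η(e_a, e_b)` of 2-forms at `x`, `e` an orthonormal
basis. -/
def formInner {x : M} (ξ η : TangentSpace (𝓡 (2 * m)) x → TangentSpace (𝓡 (2 * m)) x → ℝ) : ℝ :=
  let e := stdOrthonormalBasis ℝ (TangentSpace (𝓡 (2 * m)) x)
  1 / 2 * ∑ a, ∑ b, ξ (e a) (e b) * η (e a) (e b)

/-- The subspace `𝒩₀` of the elements `(ξ, α, u)` of `𝒩` such that `g(ξ, Ω) = u`. -/
def parallelSections₀ (nabla : CovariantDerivative (𝓡 (2 * m)) (EuclideanSpace ℝ (Fin (2 * m)))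
      (TangentSpace (𝓡 (2 * m)) : M → Type _))
    (J : ∀ x : M, TangentSpace (𝓡 (2 * m)) x →L[ℝ] TangentSpace (𝓡 (2 * m)) x) :
    Set (HypField m M) :=
  {σ | σ ∈ parallelSections nabla J ∧
    ∀ x, formInner (fun v w => σ.form x v w) (kahlerForm J x) = σ.fn x}

/-! ### The map `Q` -/

/-- The squared norm `u_φ = |φ|²`. -/
def SpinStructure.normSq (s : SpinStructure m M ι) (φ : ∀ x, s.spinorBundle.Fiber x) (x : M) : ℝ :=
  ‖s.read (φ x)‖ ^ 2

/-- The spinor `φ_{l-1} - φ_l`. -/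
def SpinStructure.tilde (s : SpinStructure m M ι)
    (J : ∀ x : M, TangentSpace (𝓡 (2 * m)) x →L[ℝ] TangentSpace (𝓡 (2 * m)) x) (l : ℕ)
    (φ : ∀ x, s.spinorBundle.Fiber x) (x : M) : SpinorModule m :=
  s.component J (l - 1) x (s.read (φ x)) - s.component J l x (s.read (φ x))

/-- The bilinear form `ξ_φ(v, w) = Im (v · w · (φ_{l-1} - φ_l), φ)`; the Hermitian product
`(ψ, φ)`, linear in `ψ`, is `inner ℂ φ ψ`. -/
def SpinStructure.xi (s : SpinStructure m M ι)
    (J : ∀ x : M, TangentSpace (𝓡 (2 * m)) x →L[ℝ] TangentSpace (𝓡 (2 * m)) x) (l : ℕ)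
    (φ : ∀ x, s.spinorBundle.Fiber x) (x : M) :
    TangentSpace (𝓡 (2 * m)) x →L[ℝ] TangentSpace (𝓡 (2 * m)) x →L[ℝ] ℝ :=
  LinearMap.toContinuousBilinearMap <| LinearMap.mk₂ ℝ
    (fun v w => (inner ℂ (s.read (φ x))
      (s.clifford x v (s.clifford x w (s.tilde J l φ x)))).im)
    (by intros; simp) (by intros; simp [inner_smul_right_eq_smul])
    (by intros; simp) (by intros; simp [inner_smul_right_eq_smul])

/-- The map `Q(φ) = (ξ_φ, J d|φ|², |φ|²)`. -/
def SpinStructure.Q (s : SpinStructure m M ι)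
    (J : ∀ x : M, TangentSpace (𝓡 (2 * m)) x →L[ℝ] TangentSpace (𝓡 (2 * m)) x) (l : ℕ)
    (φ : ∀ x, s.spinorBundle.Fiber x) : HypField m M where
  form := s.xi J l φ
  oneForm := jOneForm J (fun x => mvfderiv (𝓡 (2 * m)) (s.normSq φ) x)
  fn := s.normSq φ

end Manifold

end KahlerSpin

end

/-!
The spinors `φ` and `φ' = φ_{l-1} - φ_l` are exchanged by the Kähler form: since `m = 2l - 1`, the
form `Ω` acts as `i` on `Σ_{l-1}` and as `-i` on `Σ_l`, so that `Ω · φ = i φ'` and `Ω · φ' = i φ`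
(`IsKahlerPair`). In these terms the Killing equation reads `∇_v φ = -(i/2) v · φ - (1/2) J v · φ'`
(`SpinStructure.covDeriv_eq_of_killing`). As `Ω` is parallel and `[Ω, v] = -2 J v`, applying `-i Ω`
gives `∇_v φ' = (i/2) v · φ' + (1/2) J v · φ` (`IsKahlerPair.kahlerOp_killingDeriv`).

The operator `Ω` is skew-adjoint, hence `(v · φ', φ') = -(v · φ, φ)` and `(v · φ', φ) = -i (J v · φ,
φ)`. It follows that `d|φ|²(v) = 2 Im (v · φ, φ)`, so that `α_φ(v) = -2 Im (J v · φ, φ)`. The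
derivatives of `α_φ` and of `ξ_φ` then follow from the Leibniz rule and the Clifford relations: the
imaginary part of `(x · y · z · φ, φ)` sees only the vector part of `x · y · z`, because the totally
antisymmetric part is a self-adjoint operator. These computations at a point are the subject of
`IsKahlerPair.re_inner_killingDeriv`, `IsCliffordAction.im_inner_vector_killingDeriv` and
`IsKahlerPair.im_inner_form_killingDeriv`. Finally `(ξ_φ, Ω) = Im (Ω · φ', φ) = |φ|²`
(`IsKahlerPair.sum_im_inner`).

The Leibniz rules are proved in a local orthonormal frame, where sections of the spinor bundle are
functions with values in the spinor module and the spin connection is `d + A`. The form `A` is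
skew-adjoint because `g(∇ e_a, e_b)` is antisymmetric in `a` and `b`, and its commutator with
Clifford multiplication compensates the derivative of the frame (`SpinStructure.HasSpinDeriv.inner`,
`SpinStructure.HasSpinDeriv.clifford`, `SpinStructure.HasSpinDeriv.kahler`). The components of
`Q(φ)` at `x` are defined in a frame that depends on `x`; they can be computed in any one frame
since changes of frame act unitarily on spinors and intertwine the Clifford multiplications
(`inner_spinOp`, `SpinStructure.spinOp_frameClifford`). The same formulas show that `ξ_φ` and `α_φ`
are smooth, as they take smooth values on smooth vector fields (`contMDiffAt_hom_of_apply`).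
-/

noncomputable section

namespace KahlerSpin

/-! ### Clifford actions and the Kähler operator -/

section Algebra

variable {m : ℕ} {V : Type*} [NormedAddCommGroup V] [InnerProductSpace ℝ V]

/-- `c` is a Clifford multiplication by the vectors of `V`, by skew-adjoint operators of the spinor
module: `c v ∘ c w + c w ∘ c v = -2 ⟪v, w⟫`. -/
structure IsCliffordAction (c : V →ₗ[ℝ] Module.End ℂ (SpinorModule m)) : Prop where
  anticomm : ∀ v w ψ, c v (c w ψ) = -c w (c v ψ) - ((2 * ⟪v, w⟫_ℝ : ℝ) : ℂ) • ψ
  skew : ∀ v ψ χ, inner ℂ (c v ψ) χ = -inner ℂ ψ (c v χ)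

/-- The Clifford action `1/2 ∑_b J b · b` of the Kähler form, `b` running through an orthonormal
basis. -/
def kahlerOp {ι : Type*} [Fintype ι] (c : V →ₗ[ℝ] Module.End ℂ (SpinorModule m)) (J : V →L[ℝ] V)
    (b : OrthonormalBasis ι ℝ V) : Module.End ℂ (SpinorModule m) :=
  (1 / 2 : ℝ) • ∑ a, c (J (b a)) * c (b a)

/-- An orthogonal complex structure. -/
structure IsOrthogonalComplex (J : V →L[ℝ] V) : Prop where
  apply_apply : ∀ v, J (J v) = -v
  inner_apply : ∀ v w, ⟪J v, J w⟫_ℝ = ⟪v, w⟫_ℝ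

theorem IsOrthogonalComplex.inner_left {J : V →L[ℝ] V} (hJ : IsOrthogonalComplex J) (v w : V) :
    ⟪J v, w⟫_ℝ = -⟪v, J w⟫_ℝ := by
  rw [← hJ.inner_apply v (J w), hJ.apply_apply, inner_neg_right, neg_neg]

theorem IsOrthogonalComplex.inner_self {J : V →L[ℝ] V} (hJ : IsOrthogonalComplex J) (v : V) :
    ⟪v, J v⟫_ℝ = 0 := by
  have h := hJ.inner_left v v
  rw [real_inner_comm] at h
  linarith

variable {c : V →ₗ[ℝ] Module.End ℂ (SpinorModule m)} {J : V →L[ℝ] V}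

theorem sum_bilin_orthonormalBasis {ι ι' W : Type*} [Fintype ι] [Fintype ι'] [AddCommGroup W]
    [Module ℝ W] (B : V →ₗ[ℝ] V →ₗ[ℝ] W) (b : OrthonormalBasis ι ℝ V)
    (b' : OrthonormalBasis ι' ℝ V) : ∑ a, B (b a) (b a) = ∑ a, B (b' a) (b' a) := by
  calc ∑ a, B (b a) (b a) = ∑ a, ∑ k, ⟪b' k, b a⟫_ℝ • B (b a) (b' k) := by
        refine Finset.sum_congr rfl fun a _ => ?_
        conv_lhs => rw [← b'.sum_repr' (b a), map_sum]
        simp only [b'.sum_repr', map_smul]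
    _ = ∑ k, ∑ a, ⟪b a, b' k⟫_ℝ • B (b a) (b' k) := by
        rw [Finset.sum_comm]
        simp only [real_inner_comm]
    _ = ∑ a, B (b' a) (b' a) := by
        refine Finset.sum_congr rfl fun k _ => ?_
        conv_rhs => enter [1]; rw [← b.sum_repr' (b' k), map_sum]
        simp

/-- `v ↦ w ↦ c (J v) ∘ c w`, as a bilinear map. -/
def kahlerBilin (c : V →ₗ[ℝ] Module.End ℂ (SpinorModule m)) (J : V →L[ℝ] V) :
    V →ₗ[ℝ] V →ₗ[ℝ] Module.End ℂ (SpinorModule m) :=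
  LinearMap.mk₂ ℝ (fun v w => c (J v) * c w)
    (by intros; simp [add_mul]) (by intros; simp) (by intros; simp [mul_add]) (by intros; simp)

theorem kahlerOp_eq_kahlerOp {ι ι' : Type*} [Fintype ι] [Fintype ι']
    (b : OrthonormalBasis ι ℝ V) (b' : OrthonormalBasis ι' ℝ V) :
    kahlerOp c J b = kahlerOp c J b' := by
  unfold kahlerOp
  congr 1
  exact sum_bilin_orthonormalBasis (kahlerBilin c J) b b'

/-- The Kähler operator in terms of the components `Ω(b_k, b_a)` of the Kähler form. -/
theorem kahlerOp_eq_sum_sum {ι : Type*} [Fintype ι] (b : OrthonormalBasis ι ℝ V) :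
    kahlerOp c J b = (1 / 2 : ℝ) • ∑ k, ∑ a, ⟪b k, J (b a)⟫_ℝ • (c (b k) * c (b a)) := by
  unfold kahlerOp
  congr 1
  rw [Finset.sum_comm]
  refine Finset.sum_congr rfl fun a _ => ?_
  conv_lhs => rw [← b.sum_repr' (J (b a)), map_sum, Finset.sum_mul]
  simp

theorem real_smul_spinor (r : ℝ) (ψ : SpinorModule m) : r • ψ = (r : ℂ) • ψ := by
  ext A
  simp

/-- Commuting a vector `v` past the Kähler form produces `-2 J v`. -/
theorem IsCliffordAction.kahlerOp_comm {ι : Type*} [Fintype ι] (hc : IsCliffordAction c)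
    (hJ : IsOrthogonalComplex J) (b : OrthonormalBasis ι ℝ V) (v : V) (ψ : SpinorModule m) :
    kahlerOp c J b (c v ψ) = c v (kahlerOp c J b ψ) - (2 : ℂ) • c (J v) ψ := by
  have key (a : ι) : c (J (b a)) (c (b a) (c v ψ)) = c v (c (J (b a)) (c (b a) ψ)) +
      (2 * ⟪J (b a), v⟫_ℝ) • c (b a) ψ - (2 * ⟪b a, v⟫_ℝ) • c (J (b a)) ψ := by
    rw [hc.anticomm (b a) v, map_sub, map_neg, hc.anticomm (J (b a)) v, map_smul,
      real_smul_spinor, real_smul_spinor]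
    module
  have h1 : ∑ a, (2 * ⟪b a, v⟫_ℝ) • c (J (b a)) ψ = (2 : ℝ) • c (J v) ψ := by
    conv_rhs => rw [← b.sum_repr' v]
    simp [Finset.smul_sum, mul_smul]
  have h2 : ∑ a, (2 * ⟪J (b a), v⟫_ℝ) • c (b a) ψ = -(2 : ℝ) • c (J v) ψ := by
    conv_rhs => rw [← b.sum_repr' (J v)]
    simp [Finset.smul_sum, mul_smul, hJ.inner_left]
  have h3 : kahlerOp c J b (c v ψ) =
      c v (kahlerOp c J b ψ) + (1 / 2 : ℝ) • (-(2 : ℝ) • c (J v) ψ - (2 : ℝ) • c (J v) ψ) := by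
    rw [← h1, ← h2]
    simp only [kahlerOp, LinearMap.smul_apply, LinearMap.sum_apply, Module.End.mul_apply, key,
      Finset.sum_sub_distrib, Finset.sum_add_distrib, real_smul_spinor, map_smul, map_sum]
    module
  rw [h3, real_smul_spinor, real_smul_spinor, real_smul_spinor]
  push_cast
  module

theorem IsCliffordAction.kahlerOp_skew {ι : Type*} [Fintype ι] (hc : IsCliffordAction c)
    (hJ : IsOrthogonalComplex J) (b : OrthonormalBasis ι ℝ V) (ψ χ : SpinorModule m) :
    inner ℂ (kahlerOp c J b ψ) χ = -inner ℂ ψ (kahlerOp c J b χ) := by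
  have key (a : ι) : inner ℂ (c (J (b a)) (c (b a) ψ)) χ =
      -inner ℂ ψ (c (J (b a)) (c (b a) χ)) := by
    rw [hc.skew, hc.skew, hc.anticomm (b a), hJ.inner_self]
    simp
  simp only [kahlerOp, LinearMap.smul_apply, LinearMap.sum_apply, Module.End.mul_apply,
    real_smul_spinor, inner_smul_left, inner_smul_right, sum_inner, inner_sum, key]
  simp [Complex.conj_ofNat]

end Algebra

/-! ### Pairs of spinors exchanged by the Kähler form -/

section Pairs

variable {m : ℕ} {V : Type*} [NormedAddCommGroup V] [InnerProductSpace ℝ V]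
variable {c : V →ₗ[ℝ] Module.End ℂ (SpinorModule m)} {J : V →L[ℝ] V}
variable {ι : Type*} [Fintype ι] {b : OrthonormalBasis ι ℝ V} {K : Module.End ℂ (SpinorModule m)}
  {φ φ' : SpinorModule m}

/-- `K φ = i φ'` and `K φ' = i φ`. For `K` the Kähler operator, this says that `φ + φ'` and `φ - φ'`
lie in the eigenspaces of `i` and `-i`. -/
structure IsKahlerPair (K : Module.End ℂ (SpinorModule m)) (φ φ' : SpinorModule m) : Prop where
  apply_fst : K φ = Complex.I • φ'
  apply_snd : K φ' = Complex.I • φ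

theorem IsKahlerPair.symm (h : IsKahlerPair K φ φ') : IsKahlerPair K φ' φ :=
  ⟨h.apply_snd, h.apply_fst⟩

theorem IsCliffordAction.inner_apply (hc : IsCliffordAction c) (v : V) (ψ χ : SpinorModule m) :
    inner ℂ ψ (c v χ) = -inner ℂ (c v ψ) χ := by
  rw [hc.skew, neg_neg]

theorem re_inner_swap (ψ χ : SpinorModule m) : (inner ℂ ψ χ).re = (inner ℂ χ ψ).re := by
  rw [← inner_conj_symm, Complex.conj_re]

theorem im_inner_swap (ψ χ : SpinorModule m) : (inner ℂ ψ χ).im = -(inner ℂ χ ψ).im := by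
  rw [← inner_conj_symm, Complex.conj_im]

theorem IsCliffordAction.re_inner_self (hc : IsCliffordAction c) (v : V) (ψ : SpinorModule m) :
    (inner ℂ ψ (c v ψ)).re = 0 := by
  have h := congrArg Complex.re (hc.inner_apply v ψ ψ)
  rw [Complex.neg_re, re_inner_swap (c v ψ)] at h
  linarith

theorem IsCliffordAction.re_inner_apply_apply_self (hc : IsCliffordAction c) (v w : V)
    (ψ : SpinorModule m) : (inner ℂ ψ (c v (c w ψ))).re = -⟪v, w⟫_ℝ * ‖ψ‖ ^ 2 := by
  have h1 : inner ℂ ψ (c v (c w ψ)) = -inner ℂ (c v ψ) (c w ψ) := hc.inner_apply ..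
  have h2 : inner ℂ ψ (c v (c w ψ)) =
      inner ℂ (c w ψ) (c v ψ) - ((2 * ⟪v, w⟫_ℝ : ℝ) : ℂ) * ((‖ψ‖ ^ 2 : ℝ) : ℂ) := by
    rw [hc.anticomm v w, inner_sub_right, inner_neg_right, hc.inner_apply w, inner_smul_right,
      inner_self_eq_norm_sq_to_K, neg_neg, Complex.ofReal_pow]
    rfl
  have h3 := re_inner_swap (c w ψ) (c v ψ)
  have h1' := congrArg Complex.re h1
  have h2' := congrArg Complex.re h2
  rw [Complex.sub_re, Complex.re_ofReal_mul, Complex.ofReal_re] at h2'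
  rw [Complex.neg_re] at h1'
  linarith

/-- A product of three vectors is the sum of its vector part and of a self-adjoint operator. -/
theorem IsCliffordAction.im_inner_apply_apply_apply_self (hc : IsCliffordAction c) (x y z : V)
    (ψ : SpinorModule m) : (inner ℂ ψ (c x (c y (c z ψ)))).im =
      -⟪x, y⟫_ℝ * (inner ℂ ψ (c z ψ)).im - ⟪y, z⟫_ℝ * (inner ℂ ψ (c x ψ)).im +
        ⟪x, z⟫_ℝ * (inner ℂ ψ (c y ψ)).im := by
  have h1 : inner ℂ ψ (c x (c y (c z ψ))) = -inner ℂ (c z (c y (c x ψ))) ψ := by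
    rw [hc.inner_apply, hc.inner_apply, hc.inner_apply, neg_neg]
  have h2 : c z (c y (c x ψ)) = -c x (c y (c z ψ)) - ((2 * ⟪y, z⟫_ℝ : ℝ) : ℂ) • c x ψ +
      ((2 * ⟪x, z⟫_ℝ : ℝ) : ℂ) • c y ψ - ((2 * ⟪x, y⟫_ℝ : ℝ) : ℂ) • c z ψ := by
    rw [hc.anticomm y x, map_sub, map_neg, map_smul, hc.anticomm z x, hc.anticomm z y, map_sub,
      map_neg, map_smul, real_inner_comm x y, real_inner_comm x z, real_inner_comm y z]
    module
  have h3 := congrArg Complex.im h1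
  rw [Complex.neg_im, im_inner_swap (c z _), neg_neg, h2] at h3
  simp only [inner_sub_right, inner_add_right, inner_neg_right, inner_smul_right, Complex.sub_im,
    Complex.add_im, Complex.neg_im, Complex.im_ofReal_mul] at h3
  linarith

theorem IsCliffordAction.apply_apply_apply_comm (hc : IsCliffordAction c) (v w₁ w₂ : V)
    (ψ : SpinorModule m) : c w₁ (c w₂ (c v ψ)) = c v (c w₁ (c w₂ ψ)) +
      ((2 * ⟪v, w₁⟫_ℝ : ℝ) : ℂ) • c w₂ ψ - ((2 * ⟪v, w₂⟫_ℝ : ℝ) : ℂ) • c w₁ ψ := by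
  rw [hc.anticomm w₂ v, map_sub, map_neg, map_smul, hc.anticomm w₁ v, real_inner_comm v w₁,
    real_inner_comm v w₂]
  module

section KahlerOp

variable (hc : IsCliffordAction c) (hJ : IsOrthogonalComplex J)
include hc hJ

theorem inner_kahlerOp (ψ χ : SpinorModule m) :
    inner ℂ ψ (kahlerOp c J b χ) = -inner ℂ (kahlerOp c J b ψ) χ := by
  rw [hc.kahlerOp_skew hJ, neg_neg]

/-- The skew-adjoint operator `K` moved from the right to the left of `(v · χ, ψ)`. -/
theorem IsKahlerPair.inner_apply {ψ ψ' χ χ' : SpinorModule m}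
    (hψ : IsKahlerPair (kahlerOp c J b) ψ ψ') (hχ : IsKahlerPair (kahlerOp c J b) χ χ') (v : V) :
    Complex.I * inner ℂ ψ' (c v χ) =
      Complex.I * inner ℂ ψ (c v χ') - 2 * inner ℂ ψ (c (J v) χ) := by
  have h := inner_kahlerOp (b := b) hc hJ ψ (c v χ)
  rw [hc.kahlerOp_comm hJ, hχ.apply_fst, hψ.apply_fst, inner_sub_right, map_smul, inner_smul_right,
    inner_smul_right, inner_smul_left, Complex.conj_I] at h
  linear_combination -h

theorem IsKahlerPair.inner_apply_snd (h : IsKahlerPair (kahlerOp c J b) φ φ') (v : V) :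
    inner ℂ φ' (c v φ') = -inner ℂ φ (c v φ) := by
  have h1 := h.inner_apply hc hJ h (J v)
  have h2 := h.symm.inner_apply hc hJ h.symm (J v)
  rw [hJ.apply_apply, map_neg, LinearMap.neg_apply, inner_neg_right] at h1 h2
  linear_combination -(h1 + h2) / 2

theorem IsKahlerPair.inner_apply_fst_snd (h : IsKahlerPair (kahlerOp c J b) φ φ') (v : V) :
    inner ℂ φ (c v φ') = -Complex.I * inner ℂ φ (c (J v) φ) := by
  have h1 := h.inner_apply hc hJ h.symm (J v)
  have h2 := h.inner_apply_snd hc hJ (J v)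
  rw [hJ.apply_apply, map_neg, LinearMap.neg_apply, inner_neg_right, h2] at h1
  linear_combination -h1 / 2

theorem IsKahlerPair.norm_snd (h : IsKahlerPair (kahlerOp c J b) φ φ') : ‖φ'‖ = ‖φ‖ := by
  have h1 := inner_kahlerOp (b := b) hc hJ φ φ'
  rw [h.apply_fst, h.apply_snd, inner_smul_right, inner_smul_left, Complex.conj_I, neg_mul,
    neg_neg] at h1
  have h2 := mul_left_cancel₀ Complex.I_ne_zero h1
  rw [inner_self_eq_norm_sq_to_K, inner_self_eq_norm_sq_to_K] at h2
  have h3 : ‖φ‖ ^ 2 = ‖φ'‖ ^ 2 := by exact_mod_cast h2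
  exact ((pow_left_inj₀ (norm_nonneg _) (norm_nonneg _) two_ne_zero).1 h3).symm

theorem IsKahlerPair.im_inner (h : IsKahlerPair (kahlerOp c J b) φ φ') :
    (inner ℂ φ φ').im = 0 := by
  have h1 := inner_kahlerOp (b := b) hc hJ φ φ
  rw [h.apply_fst, inner_smul_right, inner_smul_left, Complex.conj_I, neg_mul, neg_neg] at h1
  have h2 := congrArg Complex.im (mul_left_cancel₀ Complex.I_ne_zero h1)
  have h3 := im_inner_swap φ φ'
  linarith

theorem IsKahlerPair.im_inner_self (h : IsKahlerPair (kahlerOp c J b) φ φ') (v : V) :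
    (inner ℂ φ (c v (c v φ'))).im = 0 := by
  have h1 : c v (c v φ') = ((-⟪v, v⟫_ℝ : ℝ) : ℂ) • φ' := by
    have := hc.anticomm v v φ'
    have h2 : (2 : ℂ) • c v (c v φ') = (2 : ℂ) • ((-⟪v, v⟫_ℝ : ℝ) : ℂ) • φ' := by
      rw [two_smul]
      nth_rewrite 1 [this]
      push_cast
      module
    exact smul_right_injective _ two_ne_zero h2
  rw [h1, inner_smul_right, Complex.im_ofReal_mul, h.im_inner hc hJ, mul_zero]

theorem IsKahlerPair.im_inner_comm (h : IsKahlerPair (kahlerOp c J b) φ φ') (v w : V) :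
    (inner ℂ φ (c v (c w φ'))).im = -(inner ℂ φ (c w (c v φ'))).im := by
  rw [hc.anticomm v w, inner_sub_right, inner_smul_right, Complex.sub_im, Complex.im_ofReal_mul,
    h.im_inner hc hJ, inner_neg_right, Complex.neg_im, mul_zero, sub_zero]

/-- The form `Im (v · w · φ', φ)` is `J`-invariant: moving `K` from the right to the left of
`(v · J w · φ', φ)` gives the difference of the two sides, up to a real multiple of
`(|φ|² - |φ'|²) ⟪v, J w⟫`, which vanishes. -/
theorem IsKahlerPair.im_inner_J (h : IsKahlerPair (kahlerOp c J b) φ φ') (v w : V) :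
    (inner ℂ φ (c (J v) (c (J w) φ'))).im = (inner ℂ φ (c v (c w φ'))).im := by
  have h0 := inner_kahlerOp (b := b) hc hJ φ (c v (c (J w) φ'))
  rw [hc.kahlerOp_comm hJ, hc.kahlerOp_comm hJ, hJ.apply_apply, h.apply_fst, h.apply_snd,
    inner_smul_left, Complex.conj_I] at h0
  simp only [map_sub, map_smul, map_neg, inner_sub_right, inner_smul_right, LinearMap.neg_apply,
    inner_neg_right] at h0
  have h1 := congrArg Complex.im h0
  have h2 := hc.re_inner_apply_apply_self v (J w) φ
  have h3 := hc.re_inner_apply_apply_self v (J w) φ'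
  rw [h.norm_snd hc hJ] at h3
  simp at h1
  linarith

/-! ### The Killing equation at a point -/

/-- The covariant derivative `-(i/2) v · φ - (1/2) J v · φ'` prescribed by the Killing equation. -/
def killingDeriv (c : V →ₗ[ℝ] Module.End ℂ (SpinorModule m)) (J : V →L[ℝ] V)
    (φ φ' : SpinorModule m) (v : V) : SpinorModule m :=
  -(Complex.I / 2) • c v φ - (1 / 2 : ℂ) • c (J v) φ'

/-- The Killing equation for `φ` determines the covariant derivative of `φ' = -i K φ`. -/
theorem IsKahlerPair.kahlerOp_killingDeriv (h : IsKahlerPair (kahlerOp c J b) φ φ') (v : V) :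
    -Complex.I • kahlerOp c J b (killingDeriv c J φ φ' v) =
      (Complex.I / 2) • c v φ' + (1 / 2 : ℂ) • c (J v) φ := by
  rw [killingDeriv, map_sub, map_smul, map_smul, hc.kahlerOp_comm hJ, hc.kahlerOp_comm hJ,
    hJ.apply_apply, h.apply_fst, h.apply_snd]
  simp only [map_smul, map_neg, LinearMap.neg_apply, smul_sub, smul_smul, smul_neg]
  have hI : Complex.I * Complex.I = -1 := Complex.I_mul_I
  have e1 : -Complex.I * (-(Complex.I / 2) * Complex.I) = -(Complex.I / 2) := by
    linear_combination (Complex.I / 2) * hI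
  have e2 : -Complex.I * (-(Complex.I / 2) * 2) = -1 := by linear_combination hI
  have e3 : -Complex.I * (1 / 2 * Complex.I) = 1 / 2 := by linear_combination -hI / 2
  have e4 : -Complex.I * (1 / 2 * 2) = -Complex.I := by ring
  rw [e1, e2, e3, e4]
  module

/-- Half the differential of `|φ|²` prescribed by the Killing equation. -/
theorem IsKahlerPair.re_inner_killingDeriv (h : IsKahlerPair (kahlerOp c J b) φ φ') (v : V) :
    (inner ℂ φ (killingDeriv c J φ φ' v)).re = (inner ℂ φ (c v φ)).im := by
  have h1 : inner ℂ φ (killingDeriv c J φ φ' v) = -Complex.I * inner ℂ φ (c v φ) := by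
    rw [killingDeriv, inner_sub_right, inner_smul_right, inner_smul_right,
      h.inner_apply_fst_snd hc hJ, hJ.apply_apply, map_neg, LinearMap.neg_apply, inner_neg_right]
    ring
  rw [h1]
  simp

/-- The derivative of the form `Im (w₁ · w₂ · φ', φ)` prescribed by the Killing equation. The terms
in which `v` multiplies `w₁ · w₂` reduce to contractions, and of those in which `J v` does so only
the vector part has an imaginary part. -/
theorem IsKahlerPair.im_inner_form_killingDeriv (h : IsKahlerPair (kahlerOp c J b) φ φ')
    (v w₁ w₂ : V) : (inner ℂ (killingDeriv c J φ φ' v) (c w₁ (c w₂ φ')) +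
        inner ℂ φ (c w₁ (c w₂ ((Complex.I / 2) • c v φ' + (1 / 2 : ℂ) • c (J v) φ)))).im =
      ⟪v, w₁⟫_ℝ * (inner ℂ φ (c (J w₂) φ)).im - ⟪v, w₂⟫_ℝ * (inner ℂ φ (c (J w₁) φ)).im +
        ⟪J v, w₁⟫_ℝ * (inner ℂ φ (c w₂ φ)).im - ⟪J v, w₂⟫_ℝ * (inner ℂ φ (c w₁ φ)).im := by
  have h1 : inner ℂ (killingDeriv c J φ φ' v) (c w₁ (c w₂ φ')) = -(Complex.I / 2) *
      inner ℂ φ (c v (c w₁ (c w₂ φ'))) + (1 / 2) * inner ℂ φ' (c (J v) (c w₁ (c w₂ φ'))) := by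
    rw [killingDeriv, inner_sub_left, inner_smul_left, inner_smul_left, hc.skew, hc.skew]
    simp [Complex.conj_ofNat]
    ring
  have h2 := hc.im_inner_apply_apply_apply_self (J v) w₁ w₂ φ'
  have h3 := hc.im_inner_apply_apply_apply_self w₁ w₂ (J v) φ
  rw [h.inner_apply_snd hc hJ, h.inner_apply_snd hc hJ, h.inner_apply_snd hc hJ] at h2
  have h4 := congrArg (inner ℂ φ) (hc.apply_apply_apply_comm v w₁ w₂ φ')
  rw [inner_sub_right, inner_add_right, inner_smul_right, inner_smul_right,
    h.inner_apply_fst_snd hc hJ, h.inner_apply_fst_snd hc hJ] at h4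
  rw [h1, map_add, map_add, map_smul, map_smul, map_smul, map_smul, inner_add_right,
    inner_smul_right, inner_smul_right, h4]
  have h5 := hc.re_inner_self (J w₁) φ
  have h6 := hc.re_inner_self (J w₂) φ
  rw [real_inner_comm (J v) w₁] at h3
  rw [real_inner_comm (J v) w₂] at h3
  simp
  simp at h2
  rw [h2, h3]
  ring

end KahlerOp

/-- The derivative of `Im (w · φ, φ)` prescribed by the Killing equation. -/
theorem IsCliffordAction.im_inner_vector_killingDeriv (hc : IsCliffordAction c)
    (φ φ' : SpinorModule m) (v w : V) : (inner ℂ (killingDeriv c J φ φ' v) (c w φ) +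
        inner ℂ φ (c w (killingDeriv c J φ φ' v))).im =
      ⟪w, v⟫_ℝ * ‖φ‖ ^ 2 - (inner ℂ φ (c w (c (J v) φ'))).im := by
  have h1 := congrArg Complex.im (hc.inner_apply w (killingDeriv c J φ φ' v) φ)
  rw [Complex.neg_im, im_inner_swap (c w _), neg_neg] at h1
  have h2 := hc.re_inner_apply_apply_self w v φ
  have h3 : inner ℂ φ (c w (killingDeriv c J φ φ' v)) = -(Complex.I / 2) *
      inner ℂ φ (c w (c v φ)) - (1 / 2) * inner ℂ φ (c w (c (J v) φ')) := by
    rw [killingDeriv, map_sub, map_smul, map_smul, inner_sub_right, inner_smul_right,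
      inner_smul_right]
  have h4 := congrArg Complex.im h3
  simp at h4
  rw [Complex.add_im, h1, h4, h2]
  ring

/-- The pairing of the form `Im (v · w · φ', φ)` with the Kähler form. -/
theorem IsKahlerPair.sum_im_inner (h : IsKahlerPair (kahlerOp c J b) φ φ') :
    1 / 2 * ∑ k, ∑ a, (inner ℂ φ (c (b k) (c (b a) φ'))).im * ⟪b k, J (b a)⟫_ℝ = ‖φ‖ ^ 2 := by
  have h1 : (inner ℂ φ (kahlerOp c J b φ')).im = ‖φ‖ ^ 2 := by
    rw [h.apply_snd, inner_smul_right, inner_self_eq_norm_sq_to_K, Complex.I_mul_im]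
    norm_cast
  rw [← h1, kahlerOp_eq_sum_sum]
  simp only [LinearMap.smul_apply, LinearMap.sum_apply, Module.End.mul_apply, real_smul_spinor,
    inner_smul_right, inner_sum, Complex.im_ofReal_mul, Complex.im_sum, mul_comm ⟪b _, _⟫_ℝ]

end Pairs

/-! ### Unitarity of the spin representation -/

section SpinRep

variable {m : ℕ}

/-- Exterior multiplication and contraction by `e_k` are adjoint to each other: `A ↦ A \ {k}`
matches the sets that contain `k` with those that do not. -/
theorem inner_wedgeOp (k : Fin m) (ψ χ : SpinorModule m) :
    inner ℂ (wedgeOp k ψ) χ = inner ℂ ψ (contractOp k χ) := by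
  have hconj (A : Finset (Fin m)) : (starRingEnd ℂ) (koszulSign k A) = koszulSign k A := by
    simp [koszulSign]
  simp only [PiLp.inner_apply, wedgeOp, contractOp, LinearMap.coe_mk, AddHom.coe_mk,
    RCLike.inner_apply, apply_ite (starRingEnd ℂ), map_mul, map_zero, mul_ite, mul_zero, ite_mul,
    zero_mul, hconj]
  rw [← Finset.sum_filter]
  simp only [← ite_not (k ∈ _) _ (0 : ℂ)]
  rw [← Finset.sum_filter]
  refine Finset.sum_nbij' (fun A => A.erase k) (fun A => insert k A) (by simp) (by simp) ?_ ?_ ?_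
  · intro A hA
    exact Finset.insert_erase (Finset.mem_filter.1 hA).2
  · intro A hA
    exact Finset.erase_insert (Finset.mem_filter.1 hA).2
  · intro A hA
    have hk := (Finset.mem_filter.1 hA).2
    rw [koszulSign_erase hk, if_neg (lt_irrefl k), Finset.insert_erase hk]
    ring

theorem inner_contractOp (k : Fin m) (ψ χ : SpinorModule m) :
    inner ℂ (contractOp k ψ) χ = inner ℂ ψ (wedgeOp k χ) := by
  rw [← inner_conj_symm, ← inner_wedgeOp, inner_conj_symm]

theorem inner_gamma (a : Fin m ⊕ Fin m) (ψ χ : SpinorModule m) :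
    inner ℂ (gamma a ψ) χ = -inner ℂ ψ (gamma a χ) := by
  rcases a with k | k
  · simp only [gamma, LinearMap.sub_apply, inner_sub_left, inner_sub_right, inner_wedgeOp,
      inner_contractOp, neg_sub]
  · simp only [gamma, LinearMap.smul_apply, LinearMap.add_apply, inner_smul_left, inner_smul_right,
      inner_add_left, inner_add_right, inner_wedgeOp, inner_contractOp, Complex.conj_I]
    ring

theorem cliffordMul_apply (v : Fin m ⊕ Fin m → ℝ) (ψ : SpinorModule m) :
    cliffordMul m v ψ = ∑ a, v a • gamma a ψ := by
  simp [cliffordMul, Fintype.linearCombination_apply]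

theorem inner_cliffordMul (v : Fin m ⊕ Fin m → ℝ) (ψ χ : SpinorModule m) :
    inner ℂ (cliffordMul m v ψ) χ = -inner ℂ ψ (cliffordMul m v χ) := by
  simp only [cliffordMul_apply, real_smul_spinor, sum_inner, inner_sum, inner_smul_left,
    inner_smul_right, inner_gamma, Complex.conj_ofReal, mul_neg, Finset.sum_neg_distrib]

theorem gamma_gamma_apply (a b : Fin m ⊕ Fin m) (ψ : SpinorModule m) :
    gamma a (gamma b ψ) = -gamma b (gamma a ψ) - (if a = b then (2 : ℝ) else 0) • ψ := by
  have h := LinearMap.congr_fun (gamma_anticomm a b) ψ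
  rw [LinearMap.add_apply, Module.End.mul_apply, Module.End.mul_apply] at h
  rw [eq_sub_of_add_eq h, real_smul_spinor]
  split_ifs
  · rw [show (-2 : Module.End ℂ (SpinorModule m)) = (-2 : ℂ) • 1 by
      rw [neg_smul, two_smul]; norm_num [one_add_one_eq_two]]
    simp
    abel
  · simp

theorem cliffordMul_anticomm (v w : Fin m ⊕ Fin m → ℝ) (ψ : SpinorModule m) :
    cliffordMul m v (cliffordMul m w ψ) = -cliffordMul m w (cliffordMul m v ψ) -
      ((2 * ∑ a, v a * w a : ℝ) : ℂ) • ψ := by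
  have key : (∑ a, ∑ b, (v a * w b) • gamma a (gamma b ψ)) =
      -(∑ a, ∑ b, (v a * w b) • gamma b (gamma a ψ)) - (2 * ∑ a, v a * w a) • ψ := by
    rw [Finset.mul_sum, Finset.sum_smul, ← Finset.sum_neg_distrib, ← Finset.sum_sub_distrib]
    refine Finset.sum_congr rfl fun a _ => ?_
    have h (b : Fin m ⊕ Fin m) : (v a * w b) • gamma a (gamma b ψ) =
        -((v a * w b) • gamma b (gamma a ψ)) - if a = b then (2 * (v a * w a)) • ψ else 0 := by
      rw [gamma_gamma_apply a b ψ]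
      split_ifs with hab
      · subst hab; module
      · module
    rw [Finset.sum_congr rfl fun b _ => h b, Finset.sum_sub_distrib, Finset.sum_neg_distrib,
      Finset.sum_ite_eq, if_pos (Finset.mem_univ a)]
  have h1 (v w : Fin m ⊕ Fin m → ℝ) : cliffordMul m v (cliffordMul m w ψ) =
      ∑ a, ∑ b, (v a * w b) • gamma a (gamma b ψ) := by
    simp only [cliffordMul_apply, map_sum, Finset.smul_sum, real_smul_spinor, map_smul, smul_smul,
      Complex.ofReal_mul]
    rw [Finset.sum_comm]
    simp only [mul_comm]
  rw [h1, h1, key, real_smul_spinor, Finset.sum_comm]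
  simp only [mul_comm]

/-- Vectors are skew-adjoint and `star` is the anti-automorphism changing their sign, so the spin
representation maps `star` to the adjoint. -/
theorem inner_spinRep (x : CliffordAlgebra (cliffordForm m)) (ψ χ : SpinorModule m) :
    inner ℂ (spinRep m x ψ) χ = inner ℂ ψ (spinRep m (star x) χ) := by
  induction x using CliffordAlgebra.induction generalizing ψ χ with
  | algebraMap r =>
    rw [CliffordAlgebra.star_algebraMap, AlgHom.commutes, Algebra.algebraMap_eq_smul_one,
      LinearMap.smul_apply, LinearMap.smul_apply, Module.End.one_apply, Module.End.one_apply,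
      real_smul_spinor, real_smul_spinor, inner_smul_left, inner_smul_right, Complex.conj_ofReal]
  | ι v =>
    simp [CliffordAlgebra.star_def, spinRep, inner_cliffordMul]
  | mul x y hx hy => simp [hx, hy]
  | add x y hx hy =>
    rw [map_add, star_add, map_add, LinearMap.add_apply, LinearMap.add_apply, inner_add_left,
      inner_add_right, hx, hy]

theorem spinOp_apply (g : spinGroup (cliffordForm m)) (ψ : SpinorModule m) :
    spinOp g ψ = spinRep m (g : CliffordAlgebra (cliffordForm m)) ψ := rfl

theorem inner_spinOp (g : spinGroup (cliffordForm m)) (ψ χ : SpinorModule m) :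
    inner ℂ (spinOp g ψ) (spinOp g χ) = inner ℂ ψ χ := by
  rw [spinOp_apply, spinOp_apply, inner_spinRep, ← Module.End.mul_apply, ← map_mul,
    spinGroup.coe_star_mul_self, map_one, Module.End.one_apply]

/-- If `g v g⁻¹ = w`, Clifford multiplication by `v` corresponds through `g` to that by `w`. -/
theorem spinOp_cliffordMul (g : spinGroup (cliffordForm m)) {v w : Fin m ⊕ Fin m → ℝ}
    (h : (g : CliffordAlgebra (cliffordForm m)) * CliffordAlgebra.ι (cliffordForm m) v * star g =
      CliffordAlgebra.ι (cliffordForm m) w) (ψ : SpinorModule m) :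
    spinOp g (cliffordMul m v ψ) = cliffordMul m w (spinOp g ψ) := by
  have hι (u : Fin m ⊕ Fin m → ℝ) : cliffordMul m u = spinRep m (CliffordAlgebra.ι _ u) := by
    simp [spinRep]
  rw [spinGroup.coe_star] at h
  rw [hι, hι, ← h, spinOp_apply, spinOp_apply, ← Module.End.mul_apply, ← Module.End.mul_apply,
    ← map_mul, ← map_mul, mul_assoc _ (star (g : CliffordAlgebra (cliffordForm m))),
    spinGroup.coe_star_mul_self, mul_one]

end SpinRep

section Frame

variable {m : ℕ} {M : Type*} [TopologicalSpace M]
  [ChartedSpace (EuclideanSpace ℝ (Fin (2 * m))) M] [IsManifold (𝓡 (2 * m)) ∞ M]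
  [RiemannianBundle (fun x : M => TangentSpace (𝓡 (2 * m)) x)]
  {ι : Type*}

/-! ### Spinors read in a local frame -/

theorem IsKahler.isOrthogonalComplex
    {nabla : CovariantDerivative (𝓡 (2 * m)) (EuclideanSpace ℝ (Fin (2 * m)))
      (TangentSpace (𝓡 (2 * m)) : M → Type _)}
    {J : ∀ x : M, TangentSpace (𝓡 (2 * m)) x →L[ℝ] TangentSpace (𝓡 (2 * m)) x}
    (hJ : IsKahler nabla J) (x : M) : IsOrthogonalComplex (J x) :=
  ⟨hJ.apply_apply x, hJ.inner_apply x⟩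

/-- Clifford multiplication by a tangent vector at `x`, on spinors read in the frame `i`. -/
def SpinStructure.frameClifford (s : SpinStructure m M ι) (i : ι) (x : M) :
    TangentSpace (𝓡 (2 * m)) x →ₗ[ℝ] Module.End ℂ (SpinorModule m) :=
  cliffordMul m ∘ₗ LinearMap.pi fun a => innerₗ _ (s.frame i a x)

theorem SpinStructure.frameClifford_apply (s : SpinStructure m M ι) (i : ι) {x : M}
    (v : TangentSpace (𝓡 (2 * m)) x) :
    s.frameClifford i x v = cliffordMul m (fun a => ⟪s.frame i a x, v⟫_ℝ) := rfl

/-- The frame `i`, as an orthonormal basis of the tangent space. -/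
def SpinStructure.frameBasis (s : SpinStructure m M ι) {i : ι} {x : M} (hx : x ∈ s.baseSet i) :
    OrthonormalBasis (Fin m ⊕ Fin m) ℝ (TangentSpace (𝓡 (2 * m)) x) :=
  OrthonormalBasis.mk (s.orthonormal_frame i x hx) <| by
    refine ((s.orthonormal_frame i x hx).linearIndependent.span_eq_top_of_card_eq_finrank' ?_).ge
    rw [show Module.finrank ℝ (TangentSpace (𝓡 (2 * m)) x) = 2 * m from
      finrank_euclideanSpace_fin]
    simp [two_mul]

theorem SpinStructure.frameBasis_apply (s : SpinStructure m M ι) {i : ι} {x : M}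
    (hx : x ∈ s.baseSet i) (a : Fin m ⊕ Fin m) : s.frameBasis hx a = s.frame i a x := by
  simp [frameBasis]

theorem SpinStructure.frameClifford_frame (s : SpinStructure m M ι) {i : ι} {x : M}
    (hx : x ∈ s.baseSet i) (a : Fin m ⊕ Fin m) : s.frameClifford i x (s.frame i a x) = gamma a := by
  rw [s.frameClifford_apply]
  simp only [orthonormal_iff_ite.1 (s.orthonormal_frame i x hx)]
  ext1 ψ
  simp [cliffordMul_apply]

theorem SpinStructure.isCliffordAction (s : SpinStructure m M ι) {i : ι} {x : M}
    (hx : x ∈ s.baseSet i) : IsCliffordAction (s.frameClifford i x) where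
  anticomm v w ψ := by
    have h := (s.frameBasis hx).sum_inner_mul_inner v w
    simp only [s.frameBasis_apply] at h
    rw [s.frameClifford_apply, s.frameClifford_apply, cliffordMul_anticomm, ← h]
    simp only [real_inner_comm]
  skew v ψ χ := inner_cliffordMul _ ψ χ

/-- The Clifford action of the Kähler form, on spinors read in the frame `i`. -/
def SpinStructure.frameKahler (s : SpinStructure m M ι)
    (J : ∀ x : M, TangentSpace (𝓡 (2 * m)) x →L[ℝ] TangentSpace (𝓡 (2 * m)) x) (i : ι) (x : M) :
    Module.End ℂ (SpinorModule m) :=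
  (1 / 2 : ℝ) • ∑ a, s.frameClifford i x (J x (s.frame i a x)) * s.frameClifford i x (s.frame i a x)

variable {J : ∀ x : M, TangentSpace (𝓡 (2 * m)) x →L[ℝ] TangentSpace (𝓡 (2 * m)) x}

theorem SpinStructure.frameKahler_eq (s : SpinStructure m M ι) {i : ι} {x : M}
    (hx : x ∈ s.baseSet i) :
    s.frameKahler J i x = kahlerOp (s.frameClifford i x) (J x) (s.frameBasis hx) := by
  simp only [frameKahler, kahlerOp, s.frameBasis_apply]

theorem SpinStructure.kahlerAction_eq (s : SpinStructure m M ι) (x : M) :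
    s.kahlerAction J x = s.frameKahler J (s.indexAt x) x := by
  rw [s.frameKahler_eq (s.mem_baseSet_at x), kahlerOp_eq_sum_sum]
  simp only [s.frameBasis_apply]
  rfl

/-- A change of frame intertwines the Clifford multiplications read in the two frames. -/
theorem SpinStructure.spinOp_frameClifford (s : SpinStructure m M ι) {i j : ι} {x : M}
    (hi : x ∈ s.baseSet i) (hj : x ∈ s.baseSet j) (v : TangentSpace (𝓡 (2 * m)) x)
    (ψ : SpinorModule m) :
    spinOp (s.lift i j x) (s.frameClifford j x v ψ) =
      s.frameClifford i x v (spinOp (s.lift i j x) ψ) := by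
  refine spinOp_cliffordMul _ ?_ ψ
  have h1 : (fun a => ⟪s.frame j a x, v⟫_ℝ) =
      ∑ b, ⟪s.frame j b x, v⟫_ℝ • (Pi.single b 1 : Fin m ⊕ Fin m → ℝ) := by
    ext a
    simp [Finset.sum_apply, Pi.single_apply]
  have h2 : (fun a => ⟪s.frame i a x, v⟫_ℝ) =
      ∑ b, ⟪s.frame j b x, v⟫_ℝ • fun a => ⟪s.frame i a x, s.frame j b x⟫_ℝ := by
    ext a
    have h := (s.frameBasis hj).sum_inner_mul_inner (s.frame i a x) v
    simp only [s.frameBasis_apply] at h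
    simp only [Finset.sum_apply, Pi.smul_apply, smul_eq_mul, ← h, mul_comm]
  change _ * CliffordAlgebra.ι (cliffordForm m) (fun a => ⟪s.frame j a x, v⟫_ℝ) * _ =
    CliffordAlgebra.ι (cliffordForm m) fun a => ⟪s.frame i a x, v⟫_ℝ
  rw [h1, h2, map_sum, map_sum, Finset.mul_sum, Finset.sum_mul]
  refine Finset.sum_congr rfl fun b _ => ?_
  rw [map_smul, map_smul, mul_smul_comm, smul_mul_assoc, s.lift_cover i j x ⟨hi, hj⟩ b]

theorem SpinStructure.spinOp_frameKahler (s : SpinStructure m M ι) {i j : ι} {x : M}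
    (hi : x ∈ s.baseSet i) (hj : x ∈ s.baseSet j) (ψ : SpinorModule m) :
    spinOp (s.lift i j x) (s.frameKahler J j x ψ) =
      s.frameKahler J i x (spinOp (s.lift i j x) ψ) := by
  rw [s.frameKahler_eq hi, kahlerOp_eq_kahlerOp _ (s.frameBasis hj)]
  simp only [frameKahler, kahlerOp, LinearMap.smul_apply, LinearMap.sum_apply, map_smul, map_sum,
    Module.End.mul_apply, s.frameBasis_apply, s.spinOp_frameClifford hi hj]

theorem spinOp_smul (g : spinGroup (cliffordForm m)) (z : ℂ) (ψ : SpinorModule m) :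
    spinOp g (z • ψ) = z • spinOp g ψ := by
  rw [spinOp_apply, spinOp_apply, map_smul]

/-- The section `φ` of the spinor bundle, read in the frame `i`. -/
def SpinStructure.frameSpinor (s : SpinStructure m M ι) (φ : ∀ x, s.spinorBundle.Fiber x) (i : ι)
    (x : M) : SpinorModule m :=
  s.spinorBundle.coordChange (s.indexAt x) i x (φ x)

theorem SpinStructure.frameSpinor_eq (s : SpinStructure m M ι)
    (φ : ∀ x, s.spinorBundle.Fiber x) (i : ι) (x : M) :
    s.frameSpinor φ i x = spinOp (s.lift i (s.indexAt x) x) (s.read (φ x)) := rfl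

theorem SpinStructure.frameSpinor_indexAt (s : SpinStructure m M ι)
    (φ : ∀ x, s.spinorBundle.Fiber x) (x : M) :
    s.frameSpinor φ (s.indexAt x) x = s.read (φ x) := by
  rw [s.frameSpinor_eq, s.lift_self _ x (s.mem_baseSet_at x), spinOp_one_apply]

/-- The section `φ_{l-1} - φ_l = -i Ω · φ` of the spinor bundle, read in the frame `i`. -/
def SpinStructure.framePartner (s : SpinStructure m M ι)
    (J : ∀ x : M, TangentSpace (𝓡 (2 * m)) x →L[ℝ] TangentSpace (𝓡 (2 * m)) x)
    (φ : ∀ x, s.spinorBundle.Fiber x) (i : ι) (x : M) : SpinorModule m :=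
  -Complex.I • s.frameKahler J i x (s.frameSpinor φ i x)

section Components

variable {l : ℕ} {s : SpinStructure m M ι} {φ : ∀ x, s.spinorBundle.Fiber x} {x : M}

/-- The components of a spinor of `Σ_{l-1} ⊕ Σ_l` are the eigencomponents for `±i` of the Kähler
form. -/
theorem SpinStructure.kahlerAction_component (hm : m = 2 * l - 1) (hl : 1 ≤ l)
    (hJ : IsOrthogonalComplex (J x))
    (hφ : s.read (φ x) ∈ s.degreePart J (l - 1) x ⊔ s.degreePart J l x) :
    s.read (φ x) = s.component J (l - 1) x (s.read (φ x)) + s.component J l x (s.read (φ x)) ∧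
    s.kahlerAction J x (s.component J (l - 1) x (s.read (φ x))) =
      Complex.I • s.component J (l - 1) x (s.read (φ x)) ∧
    s.kahlerAction J x (s.component J l x (s.read (φ x))) =
      -Complex.I • s.component J l x (s.read (φ x)) := by
  have e1 : Complex.I * ((m : ℂ) - 2 * ((l - 1 : ℕ) : ℂ)) = Complex.I := by
    rw [hm, Nat.cast_sub hl, Nat.cast_sub (by omega)]
    push_cast
    ring
  have e2 : Complex.I * ((m : ℂ) - 2 * (l : ℂ)) = -Complex.I := by
    rw [hm, Nat.cast_sub (by omega)]
    push_cast
    ring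
  have h1 (ψ : SpinorModule m) : ψ ∈ s.degreePart J (l - 1) x ↔
      s.kahlerAction J x ψ = Complex.I • ψ := by
    rw [degreePart, Module.End.mem_eigenspace_iff, e1]
  have h2 (ψ : SpinorModule m) : ψ ∈ s.degreePart J l x ↔
      s.kahlerAction J x ψ = -Complex.I • ψ := by
    rw [degreePart, Module.End.mem_eigenspace_iff, e2]
  have hperp {p q : SpinorModule m} (hp : p ∈ s.degreePart J (l - 1) x)
      (hq : q ∈ s.degreePart J l x) : inner ℂ p q = 0 := by
    have h := (s.isCliffordAction (s.mem_baseSet_at x)).kahlerOp_skew hJ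
      (s.frameBasis (s.mem_baseSet_at x)) p q
    rw [← s.frameKahler_eq, ← s.kahlerAction_eq, (h1 p).1 hp, (h2 q).1 hq, inner_smul_left,
      inner_smul_right, Complex.conj_I] at h
    have h' : Complex.I * inner ℂ p q = 0 := by linear_combination -h / 2
    exact (mul_eq_zero.1 h').resolve_left Complex.I_ne_zero
  obtain ⟨p, hp, q, hq, hpq⟩ := Submodule.mem_sup.1 hφ
  have hcp : s.component J (l - 1) x (s.read (φ x)) = p := by
    rw [component, ← hpq, map_add, Submodule.starProjection_eq_self_iff.2 hp,
      (Submodule.starProjection_apply_eq_zero_iff _).2, add_zero]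
    exact (Submodule.mem_orthogonal _ _).2 fun u hu => hperp hu hq
  have hcq : s.component J l x (s.read (φ x)) = q := by
    rw [component, ← hpq, map_add, Submodule.starProjection_eq_self_iff.2 hq,
      (Submodule.starProjection_apply_eq_zero_iff _).2, zero_add]
    exact (Submodule.mem_orthogonal' _ _).2 fun u hu => hperp hp hu
  rw [hcp, hcq]
  exact ⟨hpq.symm, (h1 p).1 hp, (h2 q).1 hq⟩

variable (hm : m = 2 * l - 1) (hl : 1 ≤ l) (hJ : IsOrthogonalComplex (J x))
  (hφ : s.read (φ x) ∈ s.degreePart J (l - 1) x ⊔ s.degreePart J l x)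
include hm hl hJ hφ

theorem SpinStructure.isKahlerPair_tilde :
    IsKahlerPair (s.kahlerAction J x) (s.read (φ x)) (s.tilde J l φ x) := by
  obtain ⟨h0, h1, h2⟩ := s.kahlerAction_component hm hl hJ hφ
  constructor
  · conv_lhs => rw [h0]
    rw [map_add, h1, h2, tilde]
    module
  · conv_rhs => rw [h0]
    rw [tilde, map_sub, h1, h2]
    module

theorem SpinStructure.tilde_eq :
    s.tilde J l φ x = -Complex.I • s.kahlerAction J x (s.read (φ x)) := by
  rw [(s.isKahlerPair_tilde hm hl hJ hφ).apply_fst, smul_smul]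
  simp

theorem SpinStructure.framePartner_eq {i : ι} (hx : x ∈ s.baseSet i) :
    s.framePartner J φ i x = spinOp (s.lift i (s.indexAt x) x) (s.tilde J l φ x) := by
  rw [s.tilde_eq hm hl hJ hφ, spinOp_smul, s.kahlerAction_eq,
    s.spinOp_frameKahler hx (s.mem_baseSet_at x)]
  rfl

theorem SpinStructure.framePartner_indexAt :
    s.framePartner J φ (s.indexAt x) x = s.tilde J l φ x := by
  rw [s.framePartner_eq hm hl hJ hφ (s.mem_baseSet_at x), s.lift_self _ x (s.mem_baseSet_at x),
    spinOp_one_apply]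

theorem SpinStructure.isKahlerPair_frame {i : ι} (hx : x ∈ s.baseSet i) :
    IsKahlerPair (kahlerOp (s.frameClifford i x) (J x) (s.frameBasis hx)) (s.frameSpinor φ i x)
      (s.framePartner J φ i x) := by
  have h := s.isKahlerPair_tilde hm hl hJ hφ
  rw [← s.frameKahler_eq, s.framePartner_eq hm hl hJ hφ hx, s.frameSpinor_eq]
  constructor
  · rw [← s.spinOp_frameKahler hx (s.mem_baseSet_at x), ← s.kahlerAction_eq, h.apply_fst,
      spinOp_smul]
  · rw [← s.spinOp_frameKahler hx (s.mem_baseSet_at x), ← s.kahlerAction_eq, h.apply_snd,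
      spinOp_smul]

theorem SpinStructure.xi_eq_frame {i : ι} (hx : x ∈ s.baseSet i)
    (v w : TangentSpace (𝓡 (2 * m)) x) :
    s.xi J l φ x v w = (inner ℂ (s.frameSpinor φ i x)
      (s.frameClifford i x v (s.frameClifford i x w (s.framePartner J φ i x)))).im := by
  rw [s.framePartner_eq hm hl hJ hφ hx, s.frameSpinor_eq,
    ← s.spinOp_frameClifford hx (s.mem_baseSet_at x),
    ← s.spinOp_frameClifford hx (s.mem_baseSet_at x), inner_spinOp]
  rfl

/-- The Killing equation, in terms of `φ` and of `φ_{l-1} - φ_l`. -/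
theorem SpinStructure.covDeriv_eq_of_killing
    {nabla : CovariantDerivative (𝓡 (2 * m)) (EuclideanSpace ℝ (Fin (2 * m)))
      (TangentSpace (𝓡 (2 * m)) : M → Type _)} {v : TangentSpace (𝓡 (2 * m)) x}
    (h : s.killingCovDeriv nabla J l φ x v = 0) :
    s.covDeriv nabla φ x v = killingDeriv (s.frameClifford (s.indexAt x) x) (J x)
      (s.frameSpinor φ (s.indexAt x) x) (s.framePartner J φ (s.indexAt x) x) v := by
  rw [s.frameSpinor_indexAt, s.framePartner_indexAt hm hl hJ hφ, killingDeriv, tilde]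
  have h0 := (s.kahlerAction_component hm hl hJ hφ).1
  set p := s.component J (l - 1) x (s.read (φ x)) with hp
  set q := s.component J l x (s.read (φ x)) with hq
  have hc : s.frameClifford (s.indexAt x) x = s.clifford x := rfl
  rw [hc, h0]
  rw [killingCovDeriv, ← hp, ← hq, add_assoc] at h
  rw [eq_neg_of_add_eq_zero_left h]
  simp only [clifford10, clifford01, LinearMap.smul_apply, LinearMap.sub_apply,
    LinearMap.add_apply, map_add, map_sub, smul_add, smul_sub, smul_smul]
  have e : Complex.I * (1 / 2 * Complex.I) = -(1 / 2) := by
    linear_combination Complex.I_mul_I / 2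
  rw [e]
  module

end Components

theorem SpinStructure.normSq_eq_frame (s : SpinStructure m M ι)
    (φ : ∀ x, s.spinorBundle.Fiber x) (i : ι) (x : M) :
    s.normSq φ x = (inner ℂ (s.frameSpinor φ i x) (s.frameSpinor φ i x)).re := by
  rw [s.frameSpinor_eq, inner_spinOp, inner_self_eq_norm_sq_to_K]
  norm_cast

end Frame

/-! ### Directional derivatives of vector-valued functions -/

section DirDeriv

variable {E H M : Type*} [NormedAddCommGroup E] [NormedSpace ℝ E] [TopologicalSpace H]
  {I : ModelWithCorners ℝ E H} [TopologicalSpace M] [ChartedSpace H M]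
  {F F₁ F₂ : Type*} [NormedAddCommGroup F] [NormedSpace ℝ F] [NormedAddCommGroup F₁]
  [NormedSpace ℝ F₁] [NormedAddCommGroup F₂] [NormedSpace ℝ F₂]

variable (I) in
/-- `f` is differentiable at `x`, with derivative `d` in the direction `v`. -/
structure HasDirDeriv (f : M → F) (x : M) (v : TangentSpace I x) (d : F) : Prop where
  mdifferentiableAt : MDifferentiableAt I 𝓘(ℝ, F) f x
  mvfderiv_eq : mvfderiv I f x v = d

variable {x : M} {v : TangentSpace I x}

theorem HasDirDeriv.congr {f g : M → F} {d : F} (h : HasDirDeriv I f x v d) (hfg : g =ᶠ[nhds x] f) :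
    HasDirDeriv I g x v d := by
  refine ⟨h.1.congr_of_eventuallyEq hfg, ?_⟩
  rw [← h.2]
  exact congrArg (fun L : TangentSpace I x →L[ℝ] F => L v) hfg.mfderiv_eq

theorem HasDirDeriv.const (c : F) : HasDirDeriv I (fun _ : M => c) x v 0 :=
  ⟨mdifferentiableAt_const, by rw [mvfderiv_const]; rfl⟩

theorem HasDirDeriv.bilin {B : F₁ × F₂ → F} (hB : IsBoundedBilinearMap ℝ B) {f : M → F₁}
    {g : M → F₂} {d : F₁} {e : F₂} (hf : HasDirDeriv I f x v d) (hg : HasDirDeriv I g x v e) :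
    HasDirDeriv I (fun y => B (f y, g y)) x v (B (d, g x) + B (f x, e)) := by
  have h1 : HasMFDerivAt I 𝓘(ℝ, F₁ × F₂) (fun y => (f y, g y)) x
      (ContinuousLinearMap.prod (mfderiv I 𝓘(ℝ, F₁) f x) (mfderiv I 𝓘(ℝ, F₂) g x)) :=
    ⟨hf.1.hasMFDerivAt.1.prodMk hg.1.hasMFDerivAt.1, hf.1.hasMFDerivAt.2.prodMk hg.1.hasMFDerivAt.2⟩
  have h2 := (hB.hasFDerivAt (f x, g x)).hasMFDerivAt.comp x h1
  refine ⟨h2.mdifferentiableAt, ?_⟩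
  have h3 := congrArg (fun L : TangentSpace I x →L[ℝ] F => L v) h2.mfderiv
  refine Eq.trans h3 ?_
  rw [← hf.2, ← hg.2, add_comm]
  rfl

theorem HasDirDeriv.linear (L : F₁ →L[ℝ] F) {f : M → F₁} {d : F₁} (hf : HasDirDeriv I f x v d) :
    HasDirDeriv I (fun y => L (f y)) x v (L d) := by
  have h2 := (L.hasFDerivAt (x := f x)).hasMFDerivAt.comp x hf.1.hasMFDerivAt
  refine ⟨h2.mdifferentiableAt, ?_⟩
  have h3 := congrArg (fun L : TangentSpace I x →L[ℝ] F => L v) h2.mfderiv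
  refine Eq.trans h3 ?_
  rw [← hf.2]
  rfl

theorem HasDirDeriv.add {f g : M → F} {d e : F} (hf : HasDirDeriv I f x v d)
    (hg : HasDirDeriv I g x v e) : HasDirDeriv I (fun y => f y + g y) x v (d + e) := by
  refine ⟨hf.1.add hg.1, ?_⟩
  rw [← hf.2, ← hg.2]
  exact congrArg (fun L : TangentSpace I x →L[ℝ] F => L v) (mvfderiv_add hf.1 hg.1)

theorem HasDirDeriv.sum {κ : Type*} {t : Finset κ} {f : κ → M → F} {d : κ → F}
    (h : ∀ k ∈ t, HasDirDeriv I (f k) x v (d k)) :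
    HasDirDeriv I (fun y => ∑ k ∈ t, f k y) x v (∑ k ∈ t, d k) := by
  classical
  induction t using Finset.induction_on with
  | empty => simpa using HasDirDeriv.const (0 : F)
  | insert k t hk ih =>
    simp only [Finset.sum_insert hk]
    exact (h k (Finset.mem_insert_self k t)).add
      (ih fun j hj => h j (Finset.mem_insert_of_mem hj))

theorem contMDiffAt_bilin {B : F₁ × F₂ → F} (hB : IsBoundedBilinearMap ℝ B) {f : M → F₁}
    {g : M → F₂} {n : WithTop ℕ∞} (hf : ContMDiffAt I 𝓘(ℝ, F₁) n f x)
    (hg : ContMDiffAt I 𝓘(ℝ, F₂) n g x) : ContMDiffAt I 𝓘(ℝ, F) n (fun y => B (f y, g y)) x :=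
  hB.contDiff.comp_contMDiffAt (hf.prodMk_space hg)

end DirDeriv

/-! ### Smoothness of sections of bundles of linear maps -/

section Hom

variable {E H M : Type*} [NormedAddCommGroup E] [NormedSpace ℝ E] [TopologicalSpace H]
  {I : ModelWithCorners ℝ E H} [TopologicalSpace M] [ChartedSpace H M] {n : WithTop ℕ∞}
  {F₁ F₂ : Type*} [NormedAddCommGroup F₁] [NormedSpace ℝ F₁] [FiniteDimensional ℝ F₁]
  [NormedAddCommGroup F₂] [NormedSpace ℝ F₂]

theorem contMDiffAt_clm_of_apply {f : M → F₁ →L[ℝ] F₂} {x : M}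
    (h : ∀ v, ContMDiffAt I 𝓘(ℝ, F₂) n (fun y => f y v) x) :
    ContMDiffAt I 𝓘(ℝ, F₁ →L[ℝ] F₂) n f x := by
  let b := Module.finBasis ℝ F₁
  have hf : f = fun y => ∑ k, ContinuousLinearMap.smulRightL ℝ F₁ F₂
      (LinearMap.toContinuousLinearMap (b.coord k)) (f y (b k)) := by
    ext y v
    conv_lhs => rw [← b.sum_repr v, map_sum]
    simp
  rw [hf]
  exact contMDiffAt_finsetSum fun k _ =>
    ((ContinuousLinearMap.smulRightL ℝ F₁ F₂ _).contDiff).comp_contMDiffAt (h (b k))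

variable {E₁ E₂ : M → Type*}
  [∀ x, AddCommGroup (E₁ x)] [∀ x, Module ℝ (E₁ x)] [TopologicalSpace (TotalSpace F₁ E₁)]
  [∀ x, TopologicalSpace (E₁ x)] [∀ x, AddCommGroup (E₂ x)] [∀ x, Module ℝ (E₂ x)]
  [TopologicalSpace (TotalSpace F₂ E₂)] [∀ x, TopologicalSpace (E₂ x)]
  [FiberBundle F₁ E₁] [VectorBundle ℝ F₁ E₁] [FiberBundle F₂ E₂] [VectorBundle ℝ F₂ E₂]
  [∀ x, IsTopologicalAddGroup (E₂ x)] [∀ x, ContinuousSMul ℝ (E₂ x)]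

/-- A field of linear maps is smooth if it maps smooth sections to smooth sections. -/
theorem contMDiffAt_hom_of_apply {L : ∀ x, E₁ x →L[ℝ] E₂ x} {x : M}
    (h : ∀ W : ∀ y, E₁ y, ContMDiffAt I (I.prod 𝓘(ℝ, F₁)) n (fun y => TotalSpace.mk' F₁ y (W y)) x →
      ContMDiffAt I (I.prod 𝓘(ℝ, F₂)) n (fun y => TotalSpace.mk' F₂ y (L y (W y))) x) :
    ContMDiffAt I (I.prod 𝓘(ℝ, F₁ →L[ℝ] F₂)) n
      (fun y => TotalSpace.mk' (F₁ →L[ℝ] F₂) (E := fun y => E₁ y →L[ℝ] E₂ y) y (L y)) x := by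
  rw [contMDiffAt_hom_bundle]
  refine ⟨contMDiffAt_id, contMDiffAt_clm_of_apply fun v => ?_⟩
  have hx := FiberBundle.mem_baseSet_trivializationAt' (F := F₁) (E := E₁) x
  have h1 := h _ (FiberBundle.contMDiffAt_extend I F₁ ((trivializationAt F₁ E₁ x).symm x v))
  rw [contMDiffAt_section] at h1
  refine h1.congr_of_eventuallyEq ?_
  filter_upwards [(trivializationAt F₁ E₁ x).open_baseSet.mem_nhds hx,
    (trivializationAt F₂ E₂ x).open_baseSet.mem_nhds
      (FiberBundle.mem_baseSet_trivializationAt' (F := F₂) (E := E₂) x)] with y hy1 hy2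
  simp [ContinuousLinearMap.inCoordinates, FiberBundle.extend, hx, hy1, hy2,
    Bundle.Trivialization.symmL_apply, Bundle.Trivialization.coe_linearMapAt_of_mem]

end Hom

section SpinDeriv

variable {m : ℕ} {M : Type*} [TopologicalSpace M]
  [ChartedSpace (EuclideanSpace ℝ (Fin (2 * m))) M] [IsManifold (𝓡 (2 * m)) ∞ M]
  [RiemannianBundle (fun x : M => TangentSpace (𝓡 (2 * m)) x)]
  {ι : Type*}

/-! ### The spin connection in a local frame -/

variable {nabla : CovariantDerivative (𝓡 (2 * m)) (EuclideanSpace ℝ (Fin (2 * m)))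
      (TangentSpace (𝓡 (2 * m)) : M → Type _)}

/-- The connection form `1/4 ∑_{a,b} g(∇_v e_a, e_b) e_a · e_b` of the spin connection in the
frame `i`. -/
def SpinStructure.connForm (s : SpinStructure m M ι)
    (nabla : CovariantDerivative (𝓡 (2 * m)) (EuclideanSpace ℝ (Fin (2 * m)))
      (TangentSpace (𝓡 (2 * m)) : M → Type _)) (i : ι) (x : M)
    (v : TangentSpace (𝓡 (2 * m)) x) : Module.End ℂ (SpinorModule m) :=
  (1 / 4 : ℝ) • ∑ a, ∑ b, ⟪nabla (s.frame i a) x v, s.frame i b x⟫_ℝ • (gamma a * gamma b)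

theorem SpinStructure.covDeriv_eq (s : SpinStructure m M ι) (φ : ∀ x, s.spinorBundle.Fiber x)
    (x : M) (v : TangentSpace (𝓡 (2 * m)) x) :
    s.covDeriv nabla φ x v = mvfderiv (𝓡 (2 * m)) (s.frameSpinor φ (s.indexAt x)) x v +
      s.connForm nabla (s.indexAt x) x v (s.frameSpinor φ (s.indexAt x) x) := by
  rw [s.frameSpinor_indexAt]
  simp only [covDeriv, connForm, LinearMap.smul_apply, LinearMap.sum_apply]
  rfl

theorem SpinStructure.mdifferentiableAt_frame (s : SpinStructure m M ι) {i : ι} {x : M}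
    (hx : x ∈ s.baseSet i) (a : Fin m ⊕ Fin m) :
    MDifferentiableAt (𝓡 (2 * m)) (𝓡 (2 * m)).tangent
      (fun y => (⟨y, s.frame i a y⟩ : TangentBundle (𝓡 (2 * m)) M)) x :=
  ((s.contMDiffOn_frame i a).contMDiffAt ((s.isOpen_baseSet i).mem_nhds hx)).mdifferentiableAt
    (by simp)

/-- The function `χ`, read as a section of the spinor bundle in the frame `i`, is differentiable at
`x`, with covariant derivative `d` in the direction `v`. -/
def SpinStructure.HasSpinDeriv (s : SpinStructure m M ι)
    (nabla : CovariantDerivative (𝓡 (2 * m)) (EuclideanSpace ℝ (Fin (2 * m)))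
      (TangentSpace (𝓡 (2 * m)) : M → Type _)) (i : ι) (χ : M → SpinorModule m) (x : M)
    (v : TangentSpace (𝓡 (2 * m)) x) (d : SpinorModule m) : Prop :=
  HasDirDeriv (𝓡 (2 * m)) χ x v (d - s.connForm nabla i x v (χ x))

variable {s : SpinStructure m M ι} {i : ι} {x : M} {v : TangentSpace (𝓡 (2 * m)) x}
  {J : ∀ x : M, TangentSpace (𝓡 (2 * m)) x →L[ℝ] TangentSpace (𝓡 (2 * m)) x}

theorem SpinStructure.HasSpinDeriv.smul {χ : M → SpinorModule m} {d : SpinorModule m}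
    (h : s.HasSpinDeriv nabla i χ x v d) (z : ℂ) :
    s.HasSpinDeriv nabla i (fun y => z • χ y) x v (z • d) := by
  have h' := HasDirDeriv.linear (z • ContinuousLinearMap.id ℝ (SpinorModule m)) h
  simpa [HasSpinDeriv, smul_sub] using h'

theorem SpinStructure.HasSpinDeriv.sum {κ : Type*} {t : Finset κ} {χ : κ → M → SpinorModule m}
    {d : κ → SpinorModule m} (h : ∀ k ∈ t, s.HasSpinDeriv nabla i (χ k) x v (d k)) :
    s.HasSpinDeriv nabla i (fun y => ∑ k ∈ t, χ k y) x v (∑ k ∈ t, d k) := by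
  have h' := HasDirDeriv.sum h
  simpa [HasSpinDeriv] using h'

theorem IsKahler.mdifferentiableAt_apply (hJ : IsKahler nabla J)
    {W : ∀ y : M, TangentSpace (𝓡 (2 * m)) y}
    (hW : MDifferentiableAt (𝓡 (2 * m)) (𝓡 (2 * m)).tangent
      (fun y => (⟨y, W y⟩ : TangentBundle (𝓡 (2 * m)) M)) x) :
    MDifferentiableAt (𝓡 (2 * m)) (𝓡 (2 * m)).tangent
      (fun y => (⟨y, J y (W y)⟩ : TangentBundle (𝓡 (2 * m)) M)) x :=
  MDifferentiableAt.clm_bundle_apply ((hJ.contMDiff x).mdifferentiableAt (by simp)) hW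

variable [IsContMDiffRiemannianBundle (𝓡 (2 * m)) ∞ (EuclideanSpace ℝ (Fin (2 * m)))
    (fun x : M => TangentSpace (𝓡 (2 * m)) x)]
  (hnabla : nabla.IsMetricCompatible) (hx : x ∈ s.baseSet i)

include hnabla in
theorem hasDirDeriv_inner (v : TangentSpace (𝓡 (2 * m)) x)
    {σ τ : ∀ y : M, TangentSpace (𝓡 (2 * m)) y}
    (hσ : MDifferentiableAt (𝓡 (2 * m)) (𝓡 (2 * m)).tangent
      (fun y => (⟨y, σ y⟩ : TangentBundle (𝓡 (2 * m)) M)) x)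
    (hτ : MDifferentiableAt (𝓡 (2 * m)) (𝓡 (2 * m)).tangent
      (fun y => (⟨y, τ y⟩ : TangentBundle (𝓡 (2 * m)) M)) x) :
    HasDirDeriv (𝓡 (2 * m)) (fun y => ⟪σ y, τ y⟫_ℝ) x v
      (⟪nabla σ x v, τ x⟫_ℝ + ⟪σ x, nabla τ x v⟫_ℝ) := by
  refine ⟨hσ.inner_bundle hτ, ?_⟩
  have h := hnabla.mvfderiv_inner_eq
    (FiberBundle.extend (EuclideanSpace ℝ (Fin (2 * m))) v) hσ hτ
  simpa using h

include hnabla in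
theorem SpinStructure.inner_nabla_frame (s : SpinStructure m M ι) (hx : x ∈ s.baseSet i)
    (v : TangentSpace (𝓡 (2 * m)) x) (a b : Fin m ⊕ Fin m) :
    ⟪nabla (s.frame i a) x v, s.frame i b x⟫_ℝ = -⟪nabla (s.frame i b) x v, s.frame i a x⟫_ℝ := by
  have h := hasDirDeriv_inner hnabla v (s.mdifferentiableAt_frame hx a)
    (s.mdifferentiableAt_frame hx b)
  have h0 : HasDirDeriv (𝓡 (2 * m)) (fun y => ⟪s.frame i a y, s.frame i b y⟫_ℝ) x v 0 := by
    refine (HasDirDeriv.const (if a = b then 1 else 0 : ℝ)).congr ?_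
    filter_upwards [(s.isOpen_baseSet i).mem_nhds hx] with y hy
    exact orthonormal_iff_ite.1 (s.orthonormal_frame i y hy) a b
  have h1 := h.2.symm.trans h0.2
  rw [real_inner_comm (s.frame i a x)]
  linarith

include hnabla in
theorem SpinStructure.inner_connForm (s : SpinStructure m M ι) (hx : x ∈ s.baseSet i)
    (v : TangentSpace (𝓡 (2 * m)) x) (ψ χ : SpinorModule m) :
    inner ℂ (s.connForm nabla i x v ψ) χ = -inner ℂ ψ (s.connForm nabla i x v χ) := by
  simp only [connForm, LinearMap.smul_apply, LinearMap.sum_apply, Module.End.mul_apply,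
    real_smul_spinor, inner_smul_left, inner_smul_right, sum_inner, inner_sum, inner_gamma,
    Complex.conj_ofReal, neg_neg]
  rw [Finset.sum_comm, ← mul_neg, ← Finset.sum_neg_distrib]
  congr 1
  refine Finset.sum_congr rfl fun a _ => ?_
  rw [← Finset.sum_neg_distrib]
  refine Finset.sum_congr rfl fun b _ => ?_
  rw [s.inner_nabla_frame hnabla hx v b a]
  push_cast
  ring

include hnabla in
/-- The commutator of the connection form and of Clifford multiplication by `w` compensates the
derivatives of the coefficients `⟪e_b, w⟫` of `w`. -/
theorem SpinStructure.connForm_comm (s : SpinStructure m M ι) (hx : x ∈ s.baseSet i)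
    (v : TangentSpace (𝓡 (2 * m)) x) (w : TangentSpace (𝓡 (2 * m)) x) (ψ : SpinorModule m) :
    s.connForm nabla i x v (s.frameClifford i x w ψ) =
      s.frameClifford i x w (s.connForm nabla i x v ψ) -
        ∑ b, ⟪nabla (s.frame i b) x v, w⟫_ℝ • gamma b ψ := by
  have hc := s.isCliffordAction hx
  have key (a b : Fin m ⊕ Fin m) : gamma a (gamma b (s.frameClifford i x w ψ)) =
      s.frameClifford i x w (gamma a (gamma b ψ)) + (2 * ⟪w, s.frame i a x⟫_ℝ) • gamma b ψ -
        (2 * ⟪w, s.frame i b x⟫_ℝ) • gamma a ψ := by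
    have h := hc.apply_apply_apply_comm w (s.frame i a x) (s.frame i b x) ψ
    simpa only [s.frameClifford_frame hx, ← real_smul_spinor] using h
  have h1 : ∑ a, ∑ b, ⟪nabla (s.frame i a) x v, s.frame i b x⟫_ℝ •
      ((2 * ⟪w, s.frame i a x⟫_ℝ) • gamma b ψ) =
      -(2 : ℝ) • ∑ b, ⟪nabla (s.frame i b) x v, w⟫_ℝ • gamma b ψ := by
    rw [Finset.sum_comm, Finset.smul_sum]
    refine Finset.sum_congr rfl fun b _ => ?_
    have h := (s.frameBasis hx).sum_inner_mul_inner (nabla (s.frame i b) x v) w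
    simp only [s.frameBasis_apply] at h
    simp only [smul_smul, ← Finset.sum_smul, ← h, Finset.mul_sum]
    congr 1
    refine Finset.sum_congr rfl fun a _ => ?_
    rw [s.inner_nabla_frame hnabla hx v a b, real_inner_comm w]
    ring
  have h2 : ∑ a, ∑ b, ⟪nabla (s.frame i a) x v, s.frame i b x⟫_ℝ •
      ((2 * ⟪w, s.frame i b x⟫_ℝ) • gamma a ψ) =
      (2 : ℝ) • ∑ b, ⟪nabla (s.frame i b) x v, w⟫_ℝ • gamma b ψ := by
    rw [Finset.smul_sum]
    refine Finset.sum_congr rfl fun a _ => ?_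
    have h := (s.frameBasis hx).sum_inner_mul_inner (nabla (s.frame i a) x v) w
    simp only [s.frameBasis_apply] at h
    simp only [smul_smul, ← Finset.sum_smul, ← h, Finset.mul_sum]
    congr 1
    refine Finset.sum_congr rfl fun b _ => ?_
    rw [real_inner_comm w]
    ring
  have h3 : s.connForm nabla i x v (s.frameClifford i x w ψ) =
      s.frameClifford i x w (s.connForm nabla i x v ψ) + (1 / 4 : ℝ) •
        (-(2 : ℝ) • ∑ b, ⟪nabla (s.frame i b) x v, w⟫_ℝ • gamma b ψ -
          (2 : ℝ) • ∑ b, ⟪nabla (s.frame i b) x v, w⟫_ℝ • gamma b ψ) := by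
    rw [← h1, ← h2]
    simp only [connForm, LinearMap.smul_apply, LinearMap.sum_apply, Module.End.mul_apply, key,
      smul_sub, smul_add, Finset.sum_sub_distrib, Finset.sum_add_distrib]
    simp only [real_smul_spinor, map_smul, map_sum]
    module
  rw [h3]
  module

include hnabla hx in
theorem SpinStructure.HasSpinDeriv.inner {χ₁ χ₂ : M → SpinorModule m} {d₁ d₂ : SpinorModule m}
    (h₁ : s.HasSpinDeriv nabla i χ₁ x v d₁) (h₂ : s.HasSpinDeriv nabla i χ₂ x v d₂) :
    HasDirDeriv (𝓡 (2 * m)) (fun y => inner ℂ (χ₁ y) (χ₂ y)) x v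
      (inner ℂ d₁ (χ₂ x) + inner ℂ (χ₁ x) d₂) := by
  have h := HasDirDeriv.bilin (isBoundedBilinearMap_inner (𝕜 := ℂ) (E := SpinorModule m)) h₁ h₂
  convert! h using 1
  simp only [inner_sub_left, inner_sub_right, s.inner_connForm hnabla hx]
  ring

theorem isBoundedBilinearMap_real_smul_spinor :
    IsBoundedBilinearMap ℝ (fun p : ℝ × SpinorModule m => p.1 • p.2) :=
  isBoundedBilinearMap_smul

include hnabla hx in
/-- The Leibniz rule for Clifford multiplication. -/
theorem SpinStructure.HasSpinDeriv.clifford {χ : M → SpinorModule m} {d : SpinorModule m}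
    (h : s.HasSpinDeriv nabla i χ x v d) {W : ∀ y : M, TangentSpace (𝓡 (2 * m)) y}
    (hW : MDifferentiableAt (𝓡 (2 * m)) (𝓡 (2 * m)).tangent
      (fun y => (⟨y, W y⟩ : TangentBundle (𝓡 (2 * m)) M)) x) :
    s.HasSpinDeriv nabla i (fun y => s.frameClifford i y (W y) (χ y)) x v
      (s.frameClifford i x (nabla W x v) (χ x) + s.frameClifford i x (W x) d) := by
  have h1 (a : Fin m ⊕ Fin m) := HasDirDeriv.bilin isBoundedBilinearMap_real_smul_spinor
    (hasDirDeriv_inner hnabla v (s.mdifferentiableAt_frame hx a) hW)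
    (HasDirDeriv.linear (LinearMap.toContinuousLinearMap
      ((gamma a : Module.End ℂ (SpinorModule m)).restrictScalars ℝ)) h)
  have h2 := HasDirDeriv.sum (t := Finset.univ) fun a _ => h1 a
  have e : s.frameClifford i x (nabla W x v) (χ x) + s.frameClifford i x (W x) d -
      s.connForm nabla i x v (s.frameClifford i x (W x) (χ x)) = ∑ a,
      ((⟪nabla (s.frame i a) x v, W x⟫_ℝ + ⟪s.frame i a x, nabla W x v⟫_ℝ) • gamma a (χ x) +
        ⟪s.frame i a x, W x⟫_ℝ • gamma a (d - s.connForm nabla i x v (χ x))) := by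
    rw [s.connForm_comm hnabla hx]
    simp only [s.frameClifford_apply, cliffordMul_apply, map_sub, smul_sub, add_smul,
      Finset.sum_add_distrib, Finset.sum_sub_distrib]
    abel
  rw [HasSpinDeriv, e]
  simp only [s.frameClifford_apply, cliffordMul_apply]
  exact h2

include hnabla hx in
/-- The Kähler form is parallel. -/
theorem SpinStructure.HasSpinDeriv.kahler (hJ : IsKahler nabla J) {χ : M → SpinorModule m}
    {d : SpinorModule m} (h : s.HasSpinDeriv nabla i χ x v d) :
    s.HasSpinDeriv nabla i (fun y => s.frameKahler J i y (χ y)) x v (s.frameKahler J i x d) := by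
  have h1 (a : Fin m ⊕ Fin m) := (h.clifford hnabla hx (s.mdifferentiableAt_frame hx a)).clifford
    hnabla hx (hJ.mdifferentiableAt_apply (s.mdifferentiableAt_frame hx a))
  have h2 := (HasSpinDeriv.sum (t := Finset.univ) fun a _ => h1 a).smul (1 / 2)
  -- The terms with `∇ e_a` cancel by the antisymmetry of `g(∇ e_a, e_b)` in `a` and `b`.
  have hsum : ∑ a, (s.frameClifford i x (J x (nabla (s.frame i a) x v))
        (s.frameClifford i x (s.frame i a x) (χ x)) +
      s.frameClifford i x (J x (s.frame i a x))
        (s.frameClifford i x (nabla (s.frame i a) x v) (χ x))) = 0 := by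
    have hexp (a : Fin m ⊕ Fin m) : nabla (s.frame i a) x v =
        ∑ b, ⟪nabla (s.frame i a) x v, s.frame i b x⟫_ℝ • s.frame i b x := by
      have := (s.frameBasis hx).sum_repr' (nabla (s.frame i a) x v)
      simp only [s.frameBasis_apply, real_inner_comm (nabla (s.frame i a) x v)] at this
      exact this.symm
    have e1 (a : Fin m ⊕ Fin m) : s.frameClifford i x (J x (nabla (s.frame i a) x v))
        (s.frameClifford i x (s.frame i a x) (χ x)) =
        ∑ b, ⟪nabla (s.frame i a) x v, s.frame i b x⟫_ℝ • s.frameClifford i x (J x (s.frame i b x))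
          (s.frameClifford i x (s.frame i a x) (χ x)) := by
      conv_lhs => rw [hexp a]
      simp only [map_sum, map_smul, LinearMap.sum_apply, LinearMap.smul_apply]
    have e2 (a : Fin m ⊕ Fin m) : s.frameClifford i x (J x (s.frame i a x))
        (s.frameClifford i x (nabla (s.frame i a) x v) (χ x)) =
        ∑ b, ⟪nabla (s.frame i a) x v, s.frame i b x⟫_ℝ • s.frameClifford i x (J x (s.frame i a x))
          (s.frameClifford i x (s.frame i b x) (χ x)) := by
      conv_lhs => rw [hexp a]
      simp only [map_sum, map_smul, LinearMap.sum_apply, LinearMap.smul_apply, real_smul_spinor]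
    simp only [e1, e2, Finset.sum_add_distrib]
    rw [add_comm, Finset.sum_comm, ← Finset.sum_add_distrib]
    refine Finset.sum_eq_zero fun a _ => ?_
    rw [← Finset.sum_add_distrib]
    refine Finset.sum_eq_zero fun b _ => ?_
    rw [s.inner_nabla_frame hnabla hx v b a, neg_smul, neg_add_cancel]
  have e : s.frameKahler J i x d = (1 / 2 : ℂ) • ∑ a,
      (s.frameClifford i x (nabla (fun y => J y (s.frame i a y)) x v)
          (s.frameClifford i x (s.frame i a x) (χ x)) +
        s.frameClifford i x (J x (s.frame i a x))
          (s.frameClifford i x (nabla (s.frame i a) x v) (χ x) +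
            s.frameClifford i x (s.frame i a x) d)) := by
    simp only [hJ.parallel _ x (s.mdifferentiableAt_frame hx _), map_add, ← add_assoc]
    rw [Finset.sum_add_distrib, hsum, zero_add, frameKahler, LinearMap.smul_apply, real_smul_spinor]
    simp
  rw [e]
  convert! h2 using 2 with y
  simp [frameKahler, real_smul_spinor]

end SpinDeriv

section Killing

variable {m l : ℕ} {M : Type*} [TopologicalSpace M]
  [ChartedSpace (EuclideanSpace ℝ (Fin (2 * m))) M] [IsManifold (𝓡 (2 * m)) ∞ M]
  [RiemannianBundle (fun x : M => TangentSpace (𝓡 (2 * m)) x)]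
  {ι : Type*} {s : SpinStructure m M ι} {φ : ∀ x, s.spinorBundle.Fiber x} {i : ι} {x : M}
  {J : ∀ x : M, TangentSpace (𝓡 (2 * m)) x →L[ℝ] TangentSpace (𝓡 (2 * m)) x}
  {nabla : CovariantDerivative (𝓡 (2 * m)) (EuclideanSpace ℝ (Fin (2 * m)))
      (TangentSpace (𝓡 (2 * m)) : M → Type _)}

/-! ### Derivatives of the components of `Q(φ)` -/

theorem SpinStructure.contMDiffAt_frameSpinor (hφ : ContMDiff (𝓡 (2 * m))
      ((𝓡 (2 * m)).prod 𝓘(ℝ, SpinorModule m)) ∞ (fun x => TotalSpace.mk' (SpinorModule m) x (φ x)))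
    (x : M) :
    ContMDiffAt (𝓡 (2 * m)) 𝓘(ℝ, SpinorModule m) ∞ (s.frameSpinor φ (s.indexAt x)) x :=
  (contMDiffAt_section x).1 (hφ x)

/-- The product `(v · φ, φ)` does not depend on the frame in which it is computed. -/
theorem SpinStructure.inner_frameClifford_frameSpinor (hx : x ∈ s.baseSet i)
    (v : TangentSpace (𝓡 (2 * m)) x) :
    inner ℂ (s.frameSpinor φ i x) (s.frameClifford i x v (s.frameSpinor φ i x)) =
      inner ℂ (s.frameSpinor φ (s.indexAt x) x)
        (s.frameClifford (s.indexAt x) x v (s.frameSpinor φ (s.indexAt x) x)) := by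
  rw [s.frameSpinor_indexAt, s.frameSpinor_eq, ← s.spinOp_frameClifford hx (s.mem_baseSet_at x),
    inner_spinOp]

variable [IsContMDiffRiemannianBundle (𝓡 (2 * m)) ∞ (EuclideanSpace ℝ (Fin (2 * m)))
    (fun x : M => TangentSpace (𝓡 (2 * m)) x)]

variable (hm : m = 2 * l - 1) (hl : 1 ≤ l) (hnabla : nabla.IsMetricCompatible)
  (hJ : IsKahler nabla J) (hφ : φ ∈ s.killingSpinors nabla J l)
include hm hl hJ hφ

omit [IsContMDiffRiemannianBundle (𝓡 (2 * m)) ∞ (EuclideanSpace ℝ (Fin (2 * m)))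
    (fun x : M => TangentSpace (𝓡 (2 * m)) x)] in
theorem SpinStructure.hasSpinDeriv_frameSpinor (x : M) (v : TangentSpace (𝓡 (2 * m)) x) :
    s.HasSpinDeriv nabla (s.indexAt x) (s.frameSpinor φ (s.indexAt x)) x v
      (killingDeriv (s.frameClifford (s.indexAt x) x) (J x) (s.frameSpinor φ (s.indexAt x) x)
        (s.framePartner J φ (s.indexAt x) x) v) := by
  refine ⟨(contMDiffAt_frameSpinor hφ.1 x).mdifferentiableAt (by simp), ?_⟩
  rw [← covDeriv_eq_of_killing hm hl (hJ.isOrthogonalComplex x) (hφ.2.1 x) (hφ.2.2 x v),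
    s.covDeriv_eq, add_sub_cancel_right]

include hnabla

/-- The covariant derivative of `φ_{l-1} - φ_l = -i Ω · φ`, the Kähler form being parallel. -/
theorem SpinStructure.hasSpinDeriv_framePartner (x : M) (v : TangentSpace (𝓡 (2 * m)) x) :
    s.HasSpinDeriv nabla (s.indexAt x) (s.framePartner J φ (s.indexAt x)) x v
      ((Complex.I / 2) • s.frameClifford (s.indexAt x) x v
          (s.framePartner J φ (s.indexAt x) x) +
        (1 / 2 : ℂ) • s.frameClifford (s.indexAt x) x (J x v)
          (s.frameSpinor φ (s.indexAt x) x)) := by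
  have hx := s.mem_baseSet_at x
  have h := ((hasSpinDeriv_frameSpinor hm hl hJ hφ x v).kahler hnabla hx hJ).smul (-Complex.I)
  rw [s.frameKahler_eq hx, (isKahlerPair_frame hm hl (hJ.isOrthogonalComplex x) (hφ.2.1 x)
    hx).kahlerOp_killingDeriv (s.isCliffordAction hx) (hJ.isOrthogonalComplex x)] at h
  exact h

/-- The differential of `|φ|²` is `2 Im (v · φ, φ)`. -/
theorem SpinStructure.mvfderiv_normSq (hx : x ∈ s.baseSet i) (v : TangentSpace (𝓡 (2 * m)) x) :
    mvfderiv (𝓡 (2 * m)) (s.normSq φ) x v =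
      2 * (inner ℂ (s.frameSpinor φ i x) (s.frameClifford i x v (s.frameSpinor φ i x))).im := by
  have hx' := s.mem_baseSet_at x
  have hd := hasSpinDeriv_frameSpinor hm hl hJ hφ x v
  have h := HasDirDeriv.linear Complex.reCLM (hd.inner hnabla hx' hd)
  have hfun : s.normSq φ = fun y => Complex.reCLM
      (inner ℂ (s.frameSpinor φ (s.indexAt x) y) (s.frameSpinor φ (s.indexAt x) y)) :=
    funext fun y => s.normSq_eq_frame φ _ y
  rw [hfun, h.2, inner_frameClifford_frameSpinor hx, Complex.reCLM_apply, Complex.add_re,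
    re_inner_swap (killingDeriv _ _ _ _ _),
    (isKahlerPair_frame hm hl (hJ.isOrthogonalComplex x) (hφ.2.1 x) hx').re_inner_killingDeriv
      (s.isCliffordAction hx') (hJ.isOrthogonalComplex x)]
  ring

/-- The form `α_φ = J d|φ|²` in the frame `i`. -/
theorem SpinStructure.Q_oneForm_apply (hx : x ∈ s.baseSet i) (w : TangentSpace (𝓡 (2 * m)) x) :
    (s.Q J l φ).oneForm x w =
      -2 * (inner ℂ (s.frameSpinor φ i x)
        (s.frameClifford i x (J x w) (s.frameSpinor φ i x))).im := by
  rw [neg_mul, ← mvfderiv_normSq hm hl hnabla hJ hφ hx]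
  rfl

theorem SpinStructure.jOneForm_Q_oneForm_apply (hx : x ∈ s.baseSet i)
    (w : TangentSpace (𝓡 (2 * m)) x) :
    jOneForm J (s.Q J l φ).oneForm x w =
      -2 * (inner ℂ (s.frameSpinor φ i x) (s.frameClifford i x w (s.frameSpinor φ i x))).im := by
  have h : jOneForm J (s.Q J l φ).oneForm x w = -(s.Q J l φ).oneForm x (J x w) := rfl
  rw [h, Q_oneForm_apply hm hl hnabla hJ hφ hx, hJ.apply_apply, map_neg, LinearMap.neg_apply,
    inner_neg_right, Complex.neg_im]
  ring

theorem SpinStructure.covDerivThd_Q (x : M) (v : TangentSpace (𝓡 (2 * m)) x) :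
    (s.Q J l φ).covDerivThd J x v = 0 := by
  rw [HypField.covDerivThd, jOneForm_Q_oneForm_apply hm hl hnabla hJ hφ (s.mem_baseSet_at x),
    show (s.Q J l φ).fn = s.normSq φ from rfl,
    mvfderiv_normSq hm hl hnabla hJ hφ (s.mem_baseSet_at x)]
  ring

/-- The Leibniz rule for `α_φ(W)`, with `∇_v α_φ` computed from the Killing equation. -/
theorem SpinStructure.hasDirDeriv_Q_oneForm (x : M) (v : TangentSpace (𝓡 (2 * m)) x)
    {W : ∀ y : M, TangentSpace (𝓡 (2 * m)) y}
    (hW : MDifferentiableAt (𝓡 (2 * m)) (𝓡 (2 * m)).tangent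
      (fun y => (⟨y, W y⟩ : TangentBundle (𝓡 (2 * m)) M)) x) :
    HasDirDeriv (𝓡 (2 * m)) (fun y => (s.Q J l φ).oneForm y (W y)) x v
      ((s.Q J l φ).oneForm x (nabla W x v) -
        2 * (⟪J x (W x), v⟫_ℝ * s.normSq φ x - (s.Q J l φ).form x (J x (W x)) (J x v))) := by
  have hx := s.mem_baseSet_at x
  have hd := hasSpinDeriv_frameSpinor hm hl hJ hφ x v
  have h := HasDirDeriv.linear ((-2 : ℝ) • Complex.imCLM)
    (hd.inner hnabla hx (hd.clifford hnabla hx (hJ.mdifferentiableAt_apply hW)))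
  have hkey := (s.isCliffordAction hx).im_inner_vector_killingDeriv (J := J x)
    (s.frameSpinor φ (s.indexAt x) x) (s.framePartner J φ (s.indexAt x) x) v (J x (W x))
  have e : (s.Q J l φ).oneForm x (nabla W x v) -
        2 * (⟪J x (W x), v⟫_ℝ * s.normSq φ x - (s.Q J l φ).form x (J x (W x)) (J x v)) =
      ((-2 : ℝ) • Complex.imCLM) (inner ℂ (killingDeriv (s.frameClifford (s.indexAt x) x) (J x)
          (s.frameSpinor φ (s.indexAt x) x) (s.framePartner J φ (s.indexAt x) x) v)
          (s.frameClifford (s.indexAt x) x (J x (W x)) (s.frameSpinor φ (s.indexAt x) x)) +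
        inner ℂ (s.frameSpinor φ (s.indexAt x) x)
          (s.frameClifford (s.indexAt x) x (nabla (fun y => J y (W y)) x v)
              (s.frameSpinor φ (s.indexAt x) x) +
            s.frameClifford (s.indexAt x) x (J x (W x))
              (killingDeriv (s.frameClifford (s.indexAt x) x) (J x)
                (s.frameSpinor φ (s.indexAt x) x) (s.framePartner J φ (s.indexAt x) x) v))) := by
    rw [Q_oneForm_apply hm hl hnabla hJ hφ hx, show (s.Q J l φ).form = s.xi J l φ from rfl,
      xi_eq_frame hm hl (hJ.isOrthogonalComplex x) (hφ.2.1 x) hx, hJ.parallel W x hW,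
      show s.normSq φ x = ‖s.frameSpinor φ (s.indexAt x) x‖ ^ 2 by rw [s.frameSpinor_indexAt]; rfl,
      ← hkey]
    simp only [smul_apply, Complex.imCLM_apply, inner_add_right,
      Complex.add_im, smul_eq_mul]
    ring
  rw [e]
  refine h.congr ?_
  filter_upwards [(s.isOpen_baseSet _).mem_nhds hx] with y hy
  rw [Q_oneForm_apply hm hl hnabla hJ hφ hy]
  rfl

theorem SpinStructure.covDerivSnd_Q (x : M) (v w : TangentSpace (𝓡 (2 * m)) x) :
    (s.Q J l φ).covDerivSnd nabla J x v w = 0 := by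
  have hx := s.mem_baseSet_at x
  have hJx := hJ.isOrthogonalComplex x
  have hp := isKahlerPair_frame hm hl hJx (hφ.2.1 x) hx
  have h := (hasDirDeriv_Q_oneForm hm hl hnabla hJ hφ x v (W := FiberBundle.extend _ w)
    ((FiberBundle.contMDiffAt_extend (k := 1) _ _ w).mdifferentiableAt one_ne_zero)).2
  have h1 : (s.Q J l φ).form x (J x w) (J x v) = -(s.Q J l φ).form x v w := by
    rw [show (s.Q J l φ).form = s.xi J l φ from rfl, xi_eq_frame hm hl hJx (hφ.2.1 x) hx,
      xi_eq_frame hm hl hJx (hφ.2.1 x) hx, hp.im_inner_J (s.isCliffordAction hx) hJx,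
      hp.im_inner_comm (s.isCliffordAction hx) hJx]
  rw [FiberBundle.extend_apply_self, h1] at h
  rw [HypField.covDerivSnd, covDerivOneForm, h, kahlerForm, real_inner_comm v,
    show (s.Q J l φ).fn = s.normSq φ from rfl]
  ring

/-- The Leibniz rule for `ξ_φ(W₁, W₂)`, with `∇_v ξ_φ` computed from the Killing equation. -/
theorem SpinStructure.hasDirDeriv_Q_form (x : M) (v : TangentSpace (𝓡 (2 * m)) x)
    {W₁ W₂ : ∀ y : M, TangentSpace (𝓡 (2 * m)) y}
    (hW₁ : MDifferentiableAt (𝓡 (2 * m)) (𝓡 (2 * m)).tangent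
      (fun y => (⟨y, W₁ y⟩ : TangentBundle (𝓡 (2 * m)) M)) x)
    (hW₂ : MDifferentiableAt (𝓡 (2 * m)) (𝓡 (2 * m)).tangent
      (fun y => (⟨y, W₂ y⟩ : TangentBundle (𝓡 (2 * m)) M)) x) :
    HasDirDeriv (𝓡 (2 * m)) (fun y => (s.Q J l φ).form y (W₁ y) (W₂ y)) x v
      ((s.Q J l φ).form x (nabla W₁ x v) (W₂ x) + (s.Q J l φ).form x (W₁ x) (nabla W₂ x v) -
        1 / 2 * (wedgeVec v ((s.Q J l φ).oneForm x) (W₁ x) (W₂ x) +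
          wedgeVec (J x v) (jOneForm J (s.Q J l φ).oneForm x) (W₁ x) (W₂ x))) := by
  have hx := s.mem_baseSet_at x
  have hJx := hJ.isOrthogonalComplex x
  have hp := isKahlerPair_frame hm hl hJx (hφ.2.1 x) hx
  have hd := hasSpinDeriv_frameSpinor hm hl hJ hφ x v
  have hd' := hasSpinDeriv_framePartner hm hl hnabla hJ hφ x v
  have h := HasDirDeriv.linear Complex.imCLM
    (hd.inner hnabla hx ((hd'.clifford hnabla hx hW₂).clifford hnabla hx hW₁))
  have hkey := hp.im_inner_form_killingDeriv (s.isCliffordAction hx) hJx v (W₁ x) (W₂ x)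
  have hfun : (fun y => (s.Q J l φ).form y (W₁ y) (W₂ y)) =ᶠ[nhds x] fun y =>
      Complex.imCLM (inner ℂ (s.frameSpinor φ (s.indexAt x) y)
        (s.frameClifford (s.indexAt x) y (W₁ y) (s.frameClifford (s.indexAt x) y (W₂ y)
          (s.framePartner J φ (s.indexAt x) y)))) := by
    filter_upwards [(s.isOpen_baseSet _).mem_nhds hx] with y hy
    exact xi_eq_frame hm hl (hJ.isOrthogonalComplex y) (hφ.2.1 y) hy _ _
  have h' := h.congr hfun
  refine ⟨h'.1, h'.2.trans ?_⟩
  simp only [wedgeVec, Q_oneForm_apply hm hl hnabla hJ hφ hx,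
    jOneForm_Q_oneForm_apply hm hl hnabla hJ hφ hx, show (s.Q J l φ).form = s.xi J l φ from rfl,
    xi_eq_frame hm hl hJx (hφ.2.1 x) hx]
  rw [Complex.add_im] at hkey
  simp only [Complex.imCLM_apply, inner_add_right, Complex.add_im, map_add] at hkey ⊢
  linear_combination hkey

theorem SpinStructure.covDerivFst_Q (x : M) (v w₁ w₂ : TangentSpace (𝓡 (2 * m)) x) :
    (s.Q J l φ).covDerivFst nabla J x v w₁ w₂ = 0 := by
  have h := (hasDirDeriv_Q_form hm hl hnabla hJ hφ x v (W₁ := FiberBundle.extend _ w₁)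
    (W₂ := FiberBundle.extend _ w₂)
    ((FiberBundle.contMDiffAt_extend (k := 1) _ _ w₁).mdifferentiableAt one_ne_zero)
    ((FiberBundle.contMDiffAt_extend (k := 1) _ _ w₂).mdifferentiableAt one_ne_zero)).2
  rw [FiberBundle.extend_apply_self, FiberBundle.extend_apply_self] at h
  rw [HypField.covDerivFst, covDerivForm, h]
  ring

/-! ### Smoothness of `Q(φ)` -/

omit hm hl hJ hφ hnabla in
theorem SpinStructure.contMDiffAt_frameClifford {χ : M → SpinorModule m}
    {W : ∀ y : M, TangentSpace (𝓡 (2 * m)) y} (hx : x ∈ s.baseSet i)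
    (hχ : ContMDiffAt (𝓡 (2 * m)) 𝓘(ℝ, SpinorModule m) ∞ χ x)
    (hW : ContMDiffAt (𝓡 (2 * m)) (𝓡 (2 * m)).tangent ∞
      (fun y => (⟨y, W y⟩ : TangentBundle (𝓡 (2 * m)) M)) x) :
    ContMDiffAt (𝓡 (2 * m)) 𝓘(ℝ, SpinorModule m) ∞
      (fun y => s.frameClifford i y (W y) (χ y)) x := by
  simp only [s.frameClifford_apply, cliffordMul_apply]
  refine contMDiffAt_finsetSum fun a _ => ?_
  refine contMDiffAt_bilin isBoundedBilinearMap_real_smul_spinor ?_ ?_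
  · exact ContMDiffAt.inner_bundle
      ((s.contMDiffOn_frame i a).contMDiffAt ((s.isOpen_baseSet i).mem_nhds hx)) hW
  · exact (LinearMap.toContinuousLinearMap ((gamma a : Module.End ℂ
      (SpinorModule m)).restrictScalars ℝ)).contDiff.comp_contMDiffAt hχ

omit hm hl hφ hnabla [IsContMDiffRiemannianBundle (𝓡 (2 * m)) ∞ (EuclideanSpace ℝ (Fin (2 * m)))
    (fun x : M => TangentSpace (𝓡 (2 * m)) x)] in
theorem IsKahler.contMDiffAt_apply {W : ∀ y : M, TangentSpace (𝓡 (2 * m)) y}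
    (hW : ContMDiffAt (𝓡 (2 * m)) (𝓡 (2 * m)).tangent ∞
      (fun y => (⟨y, W y⟩ : TangentBundle (𝓡 (2 * m)) M)) x) :
    ContMDiffAt (𝓡 (2 * m)) (𝓡 (2 * m)).tangent ∞
      (fun y => (⟨y, J y (W y)⟩ : TangentBundle (𝓡 (2 * m)) M)) x :=
  ContMDiffAt.clm_bundle_apply (hJ.contMDiff x) hW

omit hm hl hnabla in
theorem SpinStructure.contMDiffAt_framePartner (x : M) :
    ContMDiffAt (𝓡 (2 * m)) 𝓘(ℝ, SpinorModule m) ∞ (s.framePartner J φ (s.indexAt x)) x := by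
  have hx := s.mem_baseSet_at x
  have hframe (a : Fin m ⊕ Fin m) :=
    (s.contMDiffOn_frame (s.indexAt x) a).contMDiffAt ((s.isOpen_baseSet _).mem_nhds hx)
  have h1 := contMDiffAt_finsetSum (t := Finset.univ) fun a _ => contMDiffAt_frameClifford hx
    (contMDiffAt_frameClifford hx (contMDiffAt_frameSpinor hφ.1 x) (hframe a))
    (hJ.contMDiffAt_apply (hframe a))
  have h2 := (((-Complex.I * (1 / 2)) • ContinuousLinearMap.id ℝ (SpinorModule m)
    : SpinorModule m →L[ℝ] SpinorModule m).contDiff (n := ∞)).comp_contMDiffAt h1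
  refine h2.congr_of_eventuallyEq (Filter.Eventually.of_forall fun y => ?_)
  simp [framePartner, frameKahler, real_smul_spinor, smul_smul, -Fintype.sum_sum_type]

theorem SpinStructure.isSection_Q : (s.Q J l φ).IsSection J where
  form_self x v := by
    have hx := s.mem_baseSet_at x
    have hJx := hJ.isOrthogonalComplex x
    exact (xi_eq_frame hm hl hJx (hφ.2.1 x) hx v v).trans
      ((isKahlerPair_frame hm hl hJx (hφ.2.1 x) hx).im_inner_self (s.isCliffordAction hx) hJx v)
  form_invariant x v w := by
    have hx := s.mem_baseSet_at x
    have hJx := hJ.isOrthogonalComplex x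
    rw [show (s.Q J l φ).form = s.xi J l φ from rfl, xi_eq_frame hm hl hJx (hφ.2.1 x) hx,
      xi_eq_frame hm hl hJx (hφ.2.1 x) hx]
    exact (isKahlerPair_frame hm hl hJx (hφ.2.1 x) hx).im_inner_J (s.isCliffordAction hx) hJx v w
  contMDiff_form x := by
    have hx := s.mem_baseSet_at x
    refine contMDiffAt_hom_of_apply fun W₁ hW₁ => contMDiffAt_hom_of_apply fun W₂ hW₂ => ?_
    refine (contMDiffAt_section x).2 ?_
    have h1 := contMDiffAt_bilin (isBoundedBilinearMap_inner (𝕜 := ℂ) (E := SpinorModule m))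
      (contMDiffAt_frameSpinor hφ.1 x) (contMDiffAt_frameClifford hx (contMDiffAt_frameClifford hx
        (contMDiffAt_framePartner hJ hφ x) hW₂) hW₁)
    refine (Complex.imCLM.contDiff.comp_contMDiffAt h1).congr_of_eventuallyEq ?_
    filter_upwards [(s.isOpen_baseSet _).mem_nhds hx] with y hy
    exact xi_eq_frame hm hl (hJ.isOrthogonalComplex y) (hφ.2.1 y) hy _ _
  contMDiff_oneForm x := by
    have hx := s.mem_baseSet_at x
    refine contMDiffAt_hom_of_apply fun W hW => (contMDiffAt_section x).2 ?_
    have h1 := contMDiffAt_bilin (isBoundedBilinearMap_inner (𝕜 := ℂ) (E := SpinorModule m))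
      (contMDiffAt_frameSpinor hφ.1 x) (contMDiffAt_frameClifford hx
        (contMDiffAt_frameSpinor hφ.1 x) (hJ.contMDiffAt_apply hW))
    refine (((-2 : ℝ) • Complex.imCLM).contDiff.comp_contMDiffAt h1).congr_of_eventuallyEq ?_
    filter_upwards [(s.isOpen_baseSet _).mem_nhds hx] with y hy
    exact Q_oneForm_apply hm hl hnabla hJ hφ hy _
  contMDiff_fn x := by
    have h1 := contMDiffAt_bilin (isBoundedBilinearMap_inner (𝕜 := ℂ) (E := SpinorModule m))
      (contMDiffAt_frameSpinor hφ.1 x) (contMDiffAt_frameSpinor hφ.1 x)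
    exact (Complex.reCLM.contDiff.comp_contMDiffAt h1).congr_of_eventuallyEq
      (Filter.Eventually.of_forall fun y => s.normSq_eq_frame φ _ y)

omit hnabla [IsContMDiffRiemannianBundle (𝓡 (2 * m)) ∞ (EuclideanSpace ℝ (Fin (2 * m)))
    (fun x : M => TangentSpace (𝓡 (2 * m)) x)] in
/-- The inner product `(ξ_φ, Ω)` is `|φ|²`. -/
theorem SpinStructure.formInner_Q (x : M) :
    formInner (fun v w => (s.Q J l φ).form x v w) (kahlerForm J x) = (s.Q J l φ).fn x := by
  have hx := s.mem_baseSet_at x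
  have hJx := hJ.isOrthogonalComplex x
  have hp := isKahlerPair_frame hm hl hJx (hφ.2.1 x) hx
  rw [kahlerOp_eq_kahlerOp _ (stdOrthonormalBasis ℝ (TangentSpace (𝓡 (2 * m)) x))] at hp
  simp only [formInner, kahlerForm, show (s.Q J l φ).form = s.xi J l φ from rfl,
    xi_eq_frame hm hl hJx (hφ.2.1 x) hx]
  rw [hp.sum_im_inner, s.frameSpinor_indexAt]
  rfl

end Killing

end KahlerSpin

end

theorem mainTheorem5 {m l : ℕ} (hm : m = 2 * l - 1) (hl : 1 ≤ l)
    {M : Type*} [TopologicalSpace M]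
    [ChartedSpace (EuclideanSpace ℝ (Fin (2 * m))) M] [IsManifold (𝓡 (2 * m)) ∞ M]
    [RiemannianBundle (fun x : M => TangentSpace (𝓡 (2 * m)) x)]
    [IsContMDiffRiemannianBundle (𝓡 (2 * m)) ∞ (EuclideanSpace ℝ (Fin (2 * m)))
      (fun x : M => TangentSpace (𝓡 (2 * m)) x)]
    (nabla : CovariantDerivative (𝓡 (2 * m)) (EuclideanSpace ℝ (Fin (2 * m)))
      (TangentSpace (𝓡 (2 * m)) : M → Type _))
    (hnabla : KahlerSpin.IsLeviCivita nabla)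
    (J : ∀ x : M, TangentSpace (𝓡 (2 * m)) x →L[ℝ] TangentSpace (𝓡 (2 * m)) x)
    (hJ : KahlerSpin.IsKahler nabla J)
    {ι : Type*} (s : KahlerSpin.SpinStructure m M ι) :
    Set.MapsTo (s.Q J l) (s.killingSpinors nabla J l)
      (KahlerSpin.parallelSections₀ nabla J) := by
  intro φ hφ
  exact ⟨⟨KahlerSpin.SpinStructure.isSection_Q hm hl hnabla.2 hJ hφ, fun x v =>
    ⟨KahlerSpin.SpinStructure.covDerivFst_Q hm hl hnabla.2 hJ hφ x v,
      KahlerSpin.SpinStructure.covDerivSnd_Q hm hl hnabla.2 hJ hφ x v,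
      KahlerSpin.SpinStructure.covDerivThd_Q hm hl hnabla.2 hJ hφ x v⟩⟩,
    KahlerSpin.SpinStructure.formInner_Q hm hl hJ hφ⟩
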